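/- Let $(R,\mathfrak m)$ be a Noetherian local ring; all modules are finitely generated. Let $C$ be a semidualizing $R$-module, i.e. the homothety map $R\to\operatorname{Hom}_R(C,C)$ is an isomorphism and $\operatorname{Ext}_R^i(C,C)=0$ for $i>0$. Write $\operatorname{grade}_R(M)=\inf\{i\mid \operatorname{Ext}_R^i(M,R)\neq 0\}$. For an integer $j\ge 0$, let $\mathcal G_C^j$ be the class of $R$-modules $N$ with $\operatorname{grade}_R(N)=j$ such that $\operatorname{Ext}_R^{j+i}(N,C)=0$ and $\operatorname{Ext}_R^{j+i}(\operatorname{Ext}_R^j(N,C),C)=0$ for all $i>0$, and such that the natural map $\delta_C^j(N)\colon N\to \operatorname{Ext}_R^j(\operatorname{Ext}_R^j(N,C),C)$ is an isomorphism. For an $R$-module $M$ with $\operatorname{grade}_R(M)\ge j$, let $\operatorname{G}_C^j\text{-}\dim_R(M)$ be the least $n$ for which there is an exact sequence $0\to M_n\to\cdots\to M_0\to M\to 0$ with all $M_i\in\mathcal G_C^j$ (and $\infty$ if there is none). If $M\neq 0$ and $\operatorname{G}_C^j\text{-}\dim_R(M)<\infty$, then $$\operatorname{G}_C^j\text{-}\dim_R(M)=\operatorname{depth}(R)-\operatorname{depth}_R(M)-j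 .$$ -/

import Mathlib

universe u

noncomputable section

namespace IntermediateGorenstein

open CategoryTheory CategoryTheory.Abelian

variable {R : Type u} [CommRing R]

section Duality

variable {M : ModuleCat.{u} R} (P : ProjectiveResolution M) (C : ModuleCat.{u} R)

/-- The cochain complex `Hom(P, C)`. -/
abbrev dualComplex : CochainComplex (ModuleCat.{u} R) ℕ :=
  P.complex.linearYonedaObj R C

lemma dualComplex_d_apply (i j : ℕ) (f : P.complex.X i ⟶ C) :
    ((dualComplex P C).d i j).hom f = P.complex.d j i ≫ f := rfl

lemma extMk_zero_eq_zero (f : P.complex.X 0 ⟶ C) (hf : P.complex.d 1 0 ≫ f = 0)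
    (h : P.extMk f 1 rfl hf = 0) : f = 0 := by
  simp only [← P.extEquivCohomologyClass.apply_eq_iff_eq,
    ProjectiveResolution.extEquivCohomologyClass_extMk,
    ProjectiveResolution.extEquivCohomologyClass_zero,
    CochainComplex.HomComplex.CohomologyClass.mk_eq_zero_iff] at h
  rw [CochainComplex.HomComplex.Cocycle.toSingleMk_mem_coboundaries_iff _ _ _ _ _ 1 (by lia)] at h
  obtain ⟨g, hg⟩ := h
  rw [← cancel_epi (P.cochainComplexXIso (-(0 : ℕ)) 0 rfl).hom, ← hg,
    (P.cochainComplex.isZero_of_isStrictlyLE 0 1 (by lia)).eq_of_src g 0]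
  simp

/-- The projection of `Hom(P_n, C)` onto the cokernel of `Hom(P_(n-1), C) ⟶ Hom(P_n, C)`. -/
def toOpcycles (n : ℕ) : (P.complex.X n ⟶ C) →ₗ[R] (dualComplex P C).opcycles n :=
  ((dualComplex P C).pOpcycles n).hom

lemma toOpcycles_eq_zero_of_extMk_eq_zero (n : ℕ) (f : P.complex.X n ⟶ C)
    (hf : P.complex.d (n + 1) n ≫ f = 0) (h : P.extMk f (n + 1) rfl hf = 0) :
    toOpcycles P C n f = 0 := by
  cases n with
  | zero => rw [extMk_zero_eq_zero P C f hf h]; exact map_zero _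
  | succ n =>
    obtain ⟨g, rfl⟩ := (P.extMk_eq_zero_iff f _ rfl hf n rfl).1 h
    have := congr($((dualComplex P C).d_pOpcycles n (n + 1)).hom g)
    exact this

/-- The map sending a class in `Ext^n(M, C)`, represented by a cocycle `f : P_n ⟶ C`, to the class
of `f` in the cokernel of `Hom(P_(n-1), C) ⟶ Hom(P_n, C)`. -/
def extToOpcycles (n : ℕ) : Ext M C n →ₗ[R] (dualComplex P C).opcycles n where
  toFun e := toOpcycles P C n (P.extMk_surjective e (n + 1) rfl).choose
  map_add' e e' := by
    obtain ⟨h₁, k₁⟩ := (P.extMk_surjective e (n + 1) rfl).choose_spec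
    obtain ⟨h₂, k₂⟩ := (P.extMk_surjective e' (n + 1) rfl).choose_spec
    obtain ⟨h₃, k₃⟩ := (P.extMk_surjective (e + e') (n + 1) rfl).choose_spec
    rw [← map_add, ← sub_eq_zero, ← map_sub]
    refine toOpcycles_eq_zero_of_extMk_eq_zero P C n _
      (by simp only [Preadditive.comp_sub, Preadditive.comp_add, h₁, h₂, h₃]; simp) ?_
    rw [← P.sub_extMk _ _ _ _ h₃ (by simp only [Preadditive.comp_add, h₁, h₂]; simp),
      ← P.add_extMk _ _ _ _ h₁ h₂, k₁, k₂, k₃, sub_self]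
  map_smul' r e := by
    obtain ⟨h₁, k₁⟩ := (P.extMk_surjective e (n + 1) rfl).choose_spec
    obtain ⟨h₂, k₂⟩ := (P.extMk_surjective (r • e) (n + 1) rfl).choose_spec
    rw [RingHom.id_apply, ← map_smul, ← sub_eq_zero, ← map_sub]
    have h₃ : P.complex.d (n + 1) n ≫
        (r • (P.extMk_surjective e (n + 1) rfl).choose) = 0 := by
      rw [Linear.comp_smul, h₁, smul_zero]
    refine toOpcycles_eq_zero_of_extMk_eq_zero P C n _
      (by rw [Preadditive.comp_sub, h₂, h₃, sub_zero]) ?_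
    have h₄ : P.extMk (r • (P.extMk_surjective e (n + 1) rfl).choose) (n + 1) rfl h₃ = r • e := by
      rw [Ext.smul_eq_comp_mk₀]
      conv_rhs => rw [← k₁]
      rw [P.extMk_comp_mk₀]
      simp only [Linear.comp_smul, Category.comp_id]
    rw [← P.sub_extMk _ _ _ _ h₂ h₃, h₄, k₂, sub_self]

lemma extToOpcycles_extMk (n : ℕ) (f : P.complex.X n ⟶ C)
    (hf : P.complex.d (n + 1) n ≫ f = 0) :
    extToOpcycles P C n (P.extMk f (n + 1) rfl hf) = toOpcycles P C n f := by
  obtain ⟨h, k⟩ := (P.extMk_surjective (P.extMk f (n + 1) rfl hf) (n + 1) rfl).choose_spec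
  change toOpcycles P C n _ = _
  rw [← sub_eq_zero, ← map_sub]
  refine toOpcycles_eq_zero_of_extMk_eq_zero P C n _ (by rw [Preadditive.comp_sub, h, hf, sub_zero])
    ?_
  rw [← P.sub_extMk _ _ _ _ h hf, k, sub_self]

lemma extToOpcycles_comp_fromOpcycles (n : ℕ) :
    ModuleCat.ofHom (extToOpcycles P C n) ≫ (dualComplex P C).fromOpcycles n (n + 1) = 0 := by
  ext e
  obtain ⟨f, hf, rfl⟩ := P.extMk_surjective e (n + 1) rfl
  change ((dualComplex P C).fromOpcycles n (n + 1)).hom (extToOpcycles P C n _) = 0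
  rw [extToOpcycles_extMk]
  exact congr($((dualComplex P C).p_fromOpcycles n (n + 1)).hom f).trans hf

lemma dualComplex_exactAt (n : ℕ) (h : Subsingleton (Ext M C n)) :
    (dualComplex P C).ExactAt n := by
  cases n with
  | zero =>
    rw [HomologicalComplex.exactAt_iff' _ 0 0 1 (by simp) (by simp),
      ShortComplex.moduleCat_exact_iff]
    exact fun f hf => ⟨0, (map_zero _).trans
      (extMk_zero_eq_zero P C f hf (Subsingleton.elim _ _)).symm⟩
  | succ n =>
    rw [HomologicalComplex.exactAt_iff' _ n (n + 1) (n + 2) (by simp) (by simp),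
      ShortComplex.moduleCat_exact_iff]
    exact fun f hf => (P.extMk_eq_zero_iff f (n + 2) rfl hf n rfl).1 (Subsingleton.elim _ _)

end Duality

section Yoneda

variable (K : CochainComplex (ModuleCat.{u} R) ℕ)

/-- The sequence `K^n / B^n ⟶ K^(n+1) ⟶ K^(n+1) / B^(n+1)` attached to a cochain complex. -/
abbrev opcyclesShortComplex (n : ℕ) : ShortComplex (ModuleCat.{u} R) :=
  ShortComplex.mk (K.fromOpcycles n (n + 1)) (K.pOpcycles (n + 1)) (by
    rw [← cancel_epi (K.pOpcycles n), K.p_fromOpcycles_assoc, K.d_pOpcycles, Limits.comp_zero])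

lemma opcyclesShortComplex_shortExact (n : ℕ) (h : K.ExactAt n) :
    (opcyclesShortComplex K n).ShortExact where
  exact := by
    let S : ShortComplex (ModuleCat.{u} R) := ShortComplex.mk _ _ (K.d_pOpcycles n (n + 1))
    let φ : S ⟶ opcyclesShortComplex K n :=
      { τ₁ := K.pOpcycles n, τ₂ := 𝟙 _, τ₃ := 𝟙 _ }
    have : Epi φ.τ₁ := inferInstanceAs (Epi (K.pOpcycles n))
    have : IsIso φ.τ₂ := inferInstanceAs (IsIso (𝟙 _))
    have : Mono φ.τ₃ := inferInstanceAs (Mono (𝟙 _))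
    exact (ShortComplex.exact_iff_of_epi_of_isIso_of_mono φ).1
      (ShortComplex.exact_of_g_is_cokernel S (K.opcyclesIsCokernel n (n + 1) (by simp)))
  mono_f := Preadditive.mono_of_cancel_zero _ fun t ht => by
    rw [← Limits.Fork.IsLimit.lift_ι' (K.homologyIsKernel n (n + 1) (by simp)) t (by simpa using ht),
      (K.exactAt_iff_isZero_homology n).1 h |>.eq_of_tgt
        (Limits.Fork.IsLimit.lift (K.homologyIsKernel n (n + 1) (by simp)) t _) 0]
    simp
  epi_g := by dsimp; infer_instance

/-- The class in `Ext^n(K^n / B^n, K^0)` of the exact sequence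
`0 ⟶ K^0 ⟶ K^1 ⟶ ⋯ ⟶ K^n ⟶ K^n / B^n ⟶ 0`, for a cochain complex which is exact in
degrees `< n` (here `K^0 / B^0` is `K^0`). -/
def yonedaClass : (n : ℕ) → (∀ i < n, K.ExactAt i) → Ext (K.opcycles n) (K.opcycles 0) n
  | 0, _ => Ext.mk₀ (𝟙 _)
  | n + 1, h => (opcyclesShortComplex_shortExact K n (h n n.lt_succ_self)).extClass.comp
      (yonedaClass n fun i hi => h i (hi.trans n.lt_succ_self)) (add_comm 1 n)

lemma yonedaClass_comp (n : ℕ) (h : ∀ i < n + 1, K.ExactAt i) :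
    (yonedaClass K (n + 1) h).comp (Ext.mk₀ (K.fromOpcycles 0 1)) (add_zero _) = 0 := by
  induction n with
  | zero =>
    simp only [yonedaClass, Ext.comp_mk₀_id]
    exact ShortComplex.ShortExact.extClass_comp _
  | succ n ih =>
    rw [yonedaClass, Ext.comp_assoc _ _ _ _ (add_zero _) (by lia), ih, Ext.comp_zero]

end Yoneda

section Biduality

variable {M : ModuleCat.{u} R} (P : ProjectiveResolution M) (C : ModuleCat.{u} R)

/-- Evaluation `Hom(P_i, C) ⟶ C`, `f ↦ f x`, at an element `x` of `P_i`. -/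
def evalHom (i : ℕ) (x : P.complex.X i) : (dualComplex P C).X i ⟶ C :=
  ModuleCat.ofHom (X := (P.complex.X i ⟶ C))
    { toFun := fun f => f.hom x
      map_add' := fun _ _ => rfl
      map_smul' := fun _ _ => rfl }

lemma evalHom_add (i : ℕ) (x y : P.complex.X i) :
    evalHom P C i (x + y) = evalHom P C i x + evalHom P C i y :=
  ModuleCat.hom_ext (LinearMap.ext fun f : P.complex.X i ⟶ C => map_add f.hom x y)

lemma evalHom_smul (i : ℕ) (r : R) (x : P.complex.X i) :
    evalHom P C i (r • x) = r • evalHom P C i x :=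
  ModuleCat.hom_ext (LinearMap.ext fun f : P.complex.X i ⟶ C => map_smul f.hom r x)

lemma evalHom_d (i j : ℕ) (y : P.complex.X j) :
    evalHom P C i ((P.complex.d j i).hom y) = (dualComplex P C).d i j ≫ evalHom P C j y :=
  rfl

/-- `evalHom` on `Hom(P_0, C) / B^0 = Hom(P_0, C)`. -/
def evalOpcycles (x : P.complex.X 0) : (dualComplex P C).opcycles 0 ⟶ C :=
  (dualComplex P C).descOpcycles (evalHom P C 0 x) 0 (by simp) (by
    have : (dualComplex P C).d 0 0 = 0 := HomologicalComplex.shape _ _ _ (by simp)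
    rw [this, Limits.zero_comp])

lemma pOpcycles_evalOpcycles (x : P.complex.X 0) :
    (dualComplex P C).pOpcycles 0 ≫ evalOpcycles P C x = evalHom P C 0 x :=
  HomologicalComplex.p_descOpcycles _ _ _ _ _

/-- For `Ext^i(M, C) = 0` for `i < g`: the class in `Ext^g(Ext^g(M, C), Hom(P_0, C))` of the
exact sequence
`0 ⟶ Hom(P_0, C) ⟶ ⋯ ⟶ Hom(P_(g-1), C) ⟶ Z^g ⟶ Ext^g(M, C) ⟶ 0`, where `Z^g` is the module
of cocycles in `Hom(P_g, C)`. It is obtained by pulling back the class of the exact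
sequence `0 ⟶ Hom(P_0, C) ⟶ ⋯ ⟶ Hom(P_g, C) ⟶ Hom(P_g, C) / B^g ⟶ 0` along the
inclusion of `Ext^g(M, C)` in `Hom(P_g, C) / B^g`. -/
def universalClass (g : ℕ) (h : ∀ i < g, Subsingleton (Ext M C i)) :
    Ext (ModuleCat.of R (Ext M C g)) ((dualComplex P C).opcycles 0) g :=
  (Ext.mk₀ (ModuleCat.ofHom (extToOpcycles P C g))).comp
    (yonedaClass (dualComplex P C) g fun i hi => dualComplex_exactAt P C i (h i hi)) (zero_add g)

/-- The map `P_0 ⟶ Ext^g(Ext^g(M, C), C)` which sends `x` to the push-out of the universal class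
along evaluation at `x`. -/
def preBiduality (g : ℕ) (h : ∀ i < g, Subsingleton (Ext M C i)) :
    P.complex.X 0 →ₗ[R] Ext (ModuleCat.of R (Ext M C g)) C g where
  toFun x := (universalClass P C g h).comp (Ext.mk₀ (evalOpcycles P C x)) (add_zero g)
  map_add' x y := by
    rw [← Ext.comp_add, ← Ext.mk₀_add]
    congr 2
    rw [← cancel_epi ((dualComplex P C).pOpcycles 0)]
    rw [Preadditive.comp_add]
    simp only [pOpcycles_evalOpcycles, evalHom_add]
  map_smul' r x := by
    rw [RingHom.id_apply, ← Ext.comp_smul, ← Ext.mk₀_smul]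
    congr 2
    rw [← cancel_epi ((dualComplex P C).pOpcycles 0)]
    rw [Linear.comp_smul]
    simp only [pOpcycles_evalOpcycles, evalHom_smul]

lemma universalClass_comp (g : ℕ) (h : ∀ i < g, Subsingleton (Ext M C i)) :
    (universalClass P C g h).comp (Ext.mk₀ ((dualComplex P C).fromOpcycles 0 1))
      (add_zero g) = 0 := by
  rw [universalClass]
  cases g with
  | zero =>
    simp only [yonedaClass, Ext.comp_mk₀_id, Ext.mk₀_comp_mk₀]
    rw [extToOpcycles_comp_fromOpcycles, Ext.mk₀_zero]
  | succ g =>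
    rw [Ext.comp_assoc _ _ _ _ (add_zero _) (by lia), yonedaClass_comp, Ext.comp_zero]

lemma preBiduality_d (g : ℕ) (h : ∀ i < g, Subsingleton (Ext M C i)) (y : P.complex.X 1) :
    preBiduality P C g h ((P.complex.d 1 0).hom y) = 0 := by
  have he : evalOpcycles P C ((P.complex.d 1 0).hom y) =
      (dualComplex P C).fromOpcycles 0 1 ≫ evalHom P C 1 y := by
    rw [← cancel_epi ((dualComplex P C).pOpcycles 0), pOpcycles_evalOpcycles, evalHom_d,
      HomologicalComplex.p_fromOpcycles_assoc]
  change (universalClass P C g h).comp (Ext.mk₀ (evalOpcycles P C _)) (add_zero g) = 0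
  rw [he, ← Ext.mk₀_comp_mk₀, ← Ext.comp_assoc _ _ _ (add_zero g) (add_zero 0) (by lia),
    universalClass_comp, Ext.zero_comp]

/-- The augmentation `P_0 ⟶ M`. -/
def augmentation : P.complex.X 0 →ₗ[R] M := (P.π.f 0).hom

lemma augmentation_surjective : Function.Surjective (augmentation P) :=
  (ModuleCat.epi_iff_surjective (P.π.f 0)).1 inferInstance

lemma ker_augmentation_le (g : ℕ) (h : ∀ i < g, Subsingleton (Ext M C i)) :
    LinearMap.ker (augmentation P) ≤ LinearMap.ker (preBiduality P C g h) := by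
  intro x hx
  obtain ⟨y, rfl⟩ := (ShortComplex.moduleCat_exact_iff _).1 P.exact₀ x hx
  exact preBiduality_d P C g h y

/-- The natural map `M ⟶ Ext^g(Ext^g(M, C), C)`, computed with a projective resolution `P` of `M`:
an element of `M` lifting to `x` in `P_0` is sent to the push-out of the exact sequence
`0 ⟶ Hom(P_0, C) ⟶ ⋯ ⟶ Hom(P_(g-1), C) ⟶ Z^g ⟶ Ext^g(M, C) ⟶ 0` along evaluation at `x`. For
`g = 0` this is the map `M ⟶ Hom(Hom(M, C), C)` given by evaluation. -/
def bidualityOfResolution (g : ℕ) (h : ∀ i < g, Subsingleton (Ext M C i)) :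
    M →ₗ[R] Ext (ModuleCat.of R (Ext M C g)) C g :=
  (LinearMap.ker (augmentation P)).liftQ (preBiduality P C g h) (ker_augmentation_le P C g h) ∘ₗ
    ((augmentation P).quotKerEquivOfSurjective (augmentation_surjective P)).symm.toLinearMap

lemma bidualityOfResolution_augmentation (g : ℕ) (h : ∀ i < g, Subsingleton (Ext M C i))
    (x : P.complex.X 0) :
    bidualityOfResolution P C g h (augmentation P x) = preBiduality P C g h x := by
  have : ((augmentation P).quotKerEquivOfSurjective (augmentation_surjective P)).symm
      (augmentation P x) = Submodule.Quotient.mk x := by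
    rw [LinearEquiv.symm_apply_eq]; rfl
  simp only [bidualityOfResolution, LinearMap.comp_apply, LinearEquiv.coe_coe, this]
  exact Submodule.liftQ_apply _ _ _

/-- The natural map `δ : M ⟶ Ext^g(Ext^g(M, C), C)` for a module `M` with `Ext^i(M, C) = 0` for
`i < g`. -/
def biduality {M : ModuleCat.{u} R} (C : ModuleCat.{u} R) (g : ℕ)
    (h : ∀ i < g, Subsingleton (Ext M C i)) :
    M →ₗ[R] Ext (ModuleCat.of R (Ext M C g)) C g :=
  bidualityOfResolution (ProjectiveResolution.of M) C g h

end Biduality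

/-- `C` is semidualizing: it is finitely generated, the homothety map `R ⟶ Hom(C, C)` is an
isomorphism, and `Ext^i(C, C) = 0` for `i > 0`. -/
structure IsSemidualizing (C : ModuleCat.{u} R) : Prop where
  finite : Module.Finite R C
  homothety_bijective : Function.Bijective (algebraMap R (Module.End R C))
  ext_self : ∀ i > 0, Subsingleton (Ext C C i)

/-- The grade of `M`, that is `inf {i | Ext^i(M, R) ≠ 0}` (which is `⊤` if there is no such `i`). -/
def grade (M : ModuleCat.{u} R) : ℕ∞ :=
  ⨅ (i : ℕ) (_ : Nontrivial (Ext M (ModuleCat.of R R) i)), (i : ℕ∞)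

/-- The depth of a module `M` over a local ring: the supremum of the lengths of the `M`-regular
sequences in the maximal ideal. -/
def depth [IsLocalRing R] (M : ModuleCat.{u} R) : ℕ∞ :=
  ⨆ (rs : List R) (_ : (∀ r ∈ rs, r ∈ IsLocalRing.maximalIdeal R) ∧
    RingTheory.Sequence.IsRegular M rs), (rs.length : ℕ∞)

/-- The finitely generated module `M` of grade `g` has `G_C^g`-dimension zero. For a semidualizing
module `C` the condition `ext_lt`, under which the natural map `δ` is defined, follows from
`grade M = g`. -/
structure IsGCDimZero (C : ModuleCat.{u} R) (g : ℕ) (M : ModuleCat.{u} R) : Prop where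
  finite : Module.Finite R M
  grade_eq : grade M = g
  ext_lt : ∀ i < g, Subsingleton (Ext M C i)
  ext_gt : ∀ i > 0, Subsingleton (Ext M C (g + i))
  ext_ext_gt : ∀ i > 0, Subsingleton (Ext (ModuleCat.of R (Ext M C g)) C (g + i))
  biduality_bijective : Function.Bijective (biduality C g ext_lt)

/-- A `G_C^j`-resolution `0 ⟶ M_n ⟶ ⋯ ⟶ M_1 ⟶ M_0 ⟶ M ⟶ 0` of `M`. The sequence is continued
by zero modules beyond `M_n`. -/
structure GCResolution (C : ModuleCat.{u} R) (j : ℕ) (M : ModuleCat.{u} R) (n : ℕ) where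
  X : ℕ → ModuleCat.{u} R
  d : ∀ i, X (i + 1) →ₗ[R] X i
  ε : X 0 →ₗ[R] M
  isGCDimZero : ∀ i ≤ n, IsGCDimZero C j (X i)
  subsingleton : ∀ i > n, Subsingleton (X i)
  exact_d : ∀ i, Function.Exact (d (i + 1)) (d i)
  exact_ε : Function.Exact (d 0) ε
  surjective_ε : Function.Surjective ε

/-- `G_C^j-dim M ≤ n`, witnessed by a resolution with terms `M_0, …, M_n`, for a module `M` with
`grade M ≥ j`. -/
def HasGCDimLE (C : ModuleCat.{u} R) (j : ℕ) (M : ModuleCat.{u} R) (n : ℕ) : Prop :=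
  j ≤ grade M ∧ Nonempty (GCResolution C j M n)

/-- The `j`-th intermediate `C`-Gorenstein dimension `G_C^j-dim M`. It is `⊤` if `M` has no finite
`G_C^j`-resolution. -/
def gcDim (C : ModuleCat.{u} R) (j : ℕ) (M : ModuleCat.{u} R) : ℕ∞ :=
  ⨅ (n : ℕ) (_ : HasGCDimLE C j M n), (n : ℕ∞)
end IntermediateGorenstein
end

/-! Write `k` for the residue field. The proof rests on one duality: if `Ext^i(X, C) = 0` for `i ≠
s` and `Ext^i(T, C) = 0` for `i < m + s`, then Yoneda product with the biduality classes gives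
`Ext^m(T, Ext^s(X, C)) ≅ Hom(X, Ext^(m+s)(T, C))` (`eq_zero_of_comp_biduality_eq_zero`,
`exists_comp_biduality_eq`). It is read off from the complex `Hom(P, C)`, for `P` a projective
resolution of `X`, using `Ext^g(T, Hom(Q, C)) ≅ Hom(Q, Ext^g(T, C))` for projective `Q`
(`extEval_bijective`).

Depth is the first degree in which `Ext(k, -)` is nonzero. Taking `T = k` gives `depth Ext^s(X, C) =
depth C - s` for finitely generated `X ≠ 0` (`HasExtGrade.exists_ext`). The case `X = C`, `s = 0`
gives `depth R = depth C`. A module of `G_C^j`-dimension zero is the `Ext^j`-dual of its own dual,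
so it has depth `e = depth C - j`.

Hence all terms of a resolution have the same depth `e`. For `0 ⟶ M_1 ⟶ M_0 ⟶ M ⟶ 0`, if `Ext^j(M_0,
C) ⟶ Ext^j(M_1, C)` is onto, then `M` has `G_C^j`-dimension zero and the resolution was not shortest
(`isGCDimZero_X₃`). Otherwise the duality produces a nonzero class in `Ext^e(k, M_1)` that dies in
`M_0` (`exists_comp_eq_zero_of_not_surjective`), so `depth M = e - 1`. In a longer resolution the
first syzygy has depth less than `e`, and passing to `M` costs exactly one more. -/

noncomputable section

namespace IntermediateGorenstein

open CategoryTheory CategoryTheory.Abelian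

variable {R : Type u} [CommRing R]


/-! ### Ext into `Hom(Q, C)` for projective `Q` -/

section Evaluation

variable (Q C : ModuleCat.{u} R)

/-- Evaluation `Hom(Q, C) ⟶ C` at an element of `Q`. -/
def evalAt (x : Q) : ModuleCat.of R (Q ⟶ C) ⟶ C :=
  ModuleCat.ofHom
    { toFun := fun f => f.hom x
      map_add' := fun _ _ => rfl
      map_smul' := fun _ _ => rfl }

lemma evalAt_add (x y : Q) : evalAt Q C (x + y) = evalAt Q C x + evalAt Q C y :=
  ModuleCat.hom_ext (LinearMap.ext fun f : Q ⟶ C => map_add f.hom x y)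

lemma evalAt_smul (r : R) (x : Q) : evalAt Q C (r • x) = r • evalAt Q C x :=
  ModuleCat.hom_ext (LinearMap.ext fun f : Q ⟶ C => map_smul f.hom r x)

variable {Q C} {T : ModuleCat.{u} R}

/-- The map `Q ⟶ Ext^g(T, C)` sending `x` to the push-out of a class in `Ext^g(T, Hom(Q, C))`
along evaluation at `x`. -/
def extEval {g : ℕ} (β : Ext T (ModuleCat.of R (Q ⟶ C)) g) : Q →ₗ[R] Ext T C g where
  toFun x := β.comp (Ext.mk₀ (evalAt Q C x)) (add_zero g)
  map_add' x y := by rw [evalAt_add, Ext.mk₀_add, Ext.comp_add]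
  map_smul' r x := by rw [evalAt_smul, Ext.mk₀_smul, Ext.comp_smul, RingHom.id_apply]

lemma extEval_apply {g : ℕ} (β : Ext T (ModuleCat.of R (Q ⟶ C)) g) (x : Q) :
    extEval β x = β.comp (Ext.mk₀ (evalAt Q C x)) (add_zero g) := rfl

lemma extEval_zero_bijective :
    Function.Bijective (extEval : Ext T (ModuleCat.of R (Q ⟶ C)) 0 → _) := by
  constructor
  · intro β γ h
    obtain ⟨f, rfl⟩ := (Ext.mk₀_bijective _ _).2 β
    obtain ⟨f', rfl⟩ := (Ext.mk₀_bijective _ _).2 γ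
    congr 1
    ext t x
    have := LinearMap.congr_fun h x
    simp only [extEval_apply, Ext.mk₀_comp_mk₀] at this
    exact congr($((Ext.mk₀_bijective _ _).1 this) t)
  · intro h
    refine ⟨Ext.mk₀ (ModuleCat.ofHom (X := T)
      { toFun := fun t => (ModuleCat.ofHom
          { toFun := fun x => (Ext.linearEquiv₀ (R := R) (h x)).hom t
            map_add' := fun x y => by rw [map_add, map_add]; rfl
            map_smul' := fun r x => by rw [map_smul, map_smul]; rfl } : Q ⟶ C)
        map_add' := fun t t' => by
          ext x; exact map_add (Ext.linearEquiv₀ (R := R) (h x)).hom t t'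
        map_smul' := fun r t => by
          ext x; exact map_smul (Ext.linearEquiv₀ (R := R) (h x)).hom r t }), ?_⟩
    ext x
    rw [extEval_apply, Ext.mk₀_comp_mk₀, ← Ext.mk₀_linearEquiv₀_apply (R := R) (h x)]
    rfl

/-- Dimension shifting in `T`, with projectivity of `Q` supplying linear choices of lifts. No
finiteness of `Q` is needed, so arbitrary projective resolutions may be used later. -/
theorem extEval_bijective [Module.Projective R Q] (g : ℕ) (T : ModuleCat.{u} R) :
    Function.Bijective (extEval : Ext T (ModuleCat.of R (Q ⟶ C)) g → _) := by
  induction g generalizing T with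
  | zero => exact extEval_zero_bijective
  | succ g ih =>
    have hS := T.shortExact_projectiveShortComplex
    set S := T.projectiveShortComplex
    have : Projective S.X₂ := inferInstance
    have key (β : Ext S.X₁ (ModuleCat.of R (Q ⟶ C)) g) (x : Q) :
        extEval (hS.extClass.comp β (add_comm 1 g)) x =
          hS.extClass.comp (extEval β x) (add_comm 1 g) := by
      simp only [extEval_apply]
      exact Ext.comp_assoc_of_third_deg_zero ..
    constructor
    · intro β₁ β₂ h
      rw [← sub_eq_zero]
      obtain ⟨β', hβ'⟩ := Ext.contravariant_sequence_exact₃ hS _ (β₁ - β₂)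
        (Ext.eq_zero_of_projective _) (add_comm 1 g)
      have hz (x : Q) : hS.extClass.comp (extEval β' x) (add_comm 1 g) = 0 := by
        rw [← key, hβ']
        have := LinearMap.congr_fun h x
        rw [extEval_apply, extEval_apply] at this
        rw [extEval_apply, sub_eq_add_neg, Ext.add_comp, Ext.neg_comp, this, add_neg_cancel]
      let p : Ext S.X₂ C g →ₗ[R] Ext S.X₁ C g :=
        (Ext.mk₀ S.f).precompOfLinear R C (zero_add g)
      have hp (x : Q) : extEval β' x ∈ LinearMap.range p :=
        Ext.contravariant_sequence_exact₁ hS _ _ (add_comm 1 g) (hz x)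
      -- Each value of `extEval β'` extends to `S.X₂`. Projectivity of `Q` makes the extension
      -- linear in `x`, and the induction hypothesis for `S.X₂` turns it into a class restricting to
      -- `β'`.
      obtain ⟨l, hl⟩ := Module.projective_lifting_property p.rangeRestrict
        ((extEval β').codRestrict _ hp) p.surjective_rangeRestrict
      obtain ⟨γ, rfl⟩ := (ih S.X₂).2 l
      have : β' = (Ext.mk₀ S.f).comp γ (zero_add g) := by
        apply (ih S.X₁).1
        ext x
        have := congr(($(LinearMap.congr_fun hl x)).1)
        refine this.symm.trans ?_
        change (Ext.mk₀ S.f).comp (γ.comp _ (add_zero g)) (zero_add g) = _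
        rw [extEval_apply, Ext.comp_assoc_of_third_deg_zero]
      rw [← hβ', this, hS.extClass_comp_assoc]
    · intro h
      obtain ⟨l, hl⟩ := Module.projective_lifting_property
        (hS.extClass.precompOfLinear R C (add_comm 1 g)) h
        (precomp_extClass_surjective_of_projective_X₂ C hS g)
      obtain ⟨β, rfl⟩ := (ih S.X₁).2 l
      refine ⟨hS.extClass.comp β (add_comm 1 g), ?_⟩
      ext x
      rw [key, ← hl]
      rfl

lemma eq_zero_of_extEval_eq_zero [Module.Projective R Q] {g : ℕ}
    {β : Ext T (ModuleCat.of R (Q ⟶ C)) g} (h : ∀ x, extEval β x = 0) : β = 0 :=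
  (extEval_bijective g T).1 <| LinearMap.ext fun x => by
    rw [h, extEval_apply, Ext.zero_comp]

lemma subsingleton_ext_hom [Module.Projective R Q] {g : ℕ} (h : Subsingleton (Ext T C g)) :
    Subsingleton (Ext T (ModuleCat.of R (Q ⟶ C)) g) :=
  subsingleton_of_forall_eq 0 fun _ => eq_zero_of_extEval_eq_zero fun _ => Subsingleton.elim _ _

end Evaluation


/-! ### Products with the Yoneda class of a cochain complex -/

section YonedaClass

variable (K : CochainComplex (ModuleCat.{u} R) ℕ) {T : ModuleCat.{u} R} {g : ℕ}

lemma ext_comp_injective_of_mono {A B : ModuleCat.{u} R} (f : A ⟶ B) [Mono f] {α : Ext T A 0}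
    (h : α.comp (Ext.mk₀ f) (add_zero 0) = 0) : α = 0 :=
  Ext.postcomp_mk₀_injective_of_mono T f
    (h.trans (Ext.zero_comp (n := 0) T (Ext.mk₀ f) 0 (add_zero 0)).symm)

/-- The product is a composite of connecting maps, each injective because `Ext(T, K^n)` vanishes in
the degree just before. -/
lemma eq_zero_of_comp_yonedaClass_eq_zero (hT : ∀ i < g, ∀ n, Subsingleton (Ext T (K.X n) i))
    (s : ℕ) (h : ∀ i < s, K.ExactAt i) (m : ℕ) (hm : m + s ≤ g) {k : ℕ} (hk : m + s = k)
    (α : Ext T (K.opcycles s) m) (hα : α.comp (yonedaClass K s h) hk = 0) : α = 0 := by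
  induction s generalizing m with
  | zero =>
    obtain rfl : m = k := hk
    simpa [yonedaClass] using hα
  | succ s ih =>
    rw [yonedaClass, ← Ext.comp_assoc _ _ _ rfl _ (by lia)] at hα
    obtain ⟨y, rfl⟩ := Ext.covariant_sequence_exact₃ _ (opcyclesShortComplex_shortExact K s
      (h s s.lt_succ_self)) α rfl (ih _ (m + 1) (by lia) (by lia) _ hα)
    have := hT m (by lia) (s + 1)
    rw [Subsingleton.elim (α := Ext T (K.X (s + 1)) m) y 0, Ext.zero_comp]

/-- A class killed in `K^(s+1)` lifts through the connecting map. Its lift has degree below `g`, so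
it is automatically killed in `K^(s+2)` and the process continues; only the first step uses `hβ`. -/
lemma exists_comp_yonedaClass_eq (hT : ∀ i < g, ∀ n, Subsingleton (Ext T (K.X n) i))
    (s : ℕ) (h : ∀ i < s, K.ExactAt i) (m : ℕ) {k : ℕ} (hm : k ≤ g) (hk : m + s = k)
    (β : Ext T (K.opcycles 0) k)
    (hβ : β.comp (Ext.mk₀ (K.fromOpcycles 0 1)) (add_zero k) = 0) :
    ∃ α : Ext T (K.opcycles s) m,
      α.comp (Ext.mk₀ (K.fromOpcycles s (s + 1))) (add_zero m) = 0 ∧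
      α.comp (yonedaClass K s h) hk = β := by
  induction s generalizing m with
  | zero =>
    obtain rfl : m = k := hk
    exact ⟨β, hβ, by simp [yonedaClass]⟩
  | succ s ih =>
    obtain ⟨γ, hγ, rfl⟩ := ih (fun i hi => h i (hi.trans s.lt_succ_self)) (m + 1) (by lia)
    obtain ⟨α, rfl⟩ := Ext.covariant_sequence_exact₁ _ (opcyclesShortComplex_shortExact K s
      (h s s.lt_succ_self)) γ hγ rfl
    have := hT m (by lia) (s + 1 + 1)
    refine ⟨α, Subsingleton.elim _ _, ?_⟩
    rw [yonedaClass, ← Ext.comp_assoc _ _ _ rfl _ (by lia)]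

/-- Beyond `s` the module `K^n / B^n` embeds in `K^(n+1)` with cokernel `K^(n+1) / B^(n+1)`. Moving
one place to the right lowers the Ext degree, so the induction ends although the complex need not be
bounded. -/
lemma subsingleton_ext_opcycles (hT : ∀ i < g, ∀ n, Subsingleton (Ext T (K.X n) i)) {s : ℕ}
    (h : ∀ n > s, K.ExactAt n) (i : ℕ) (hi : i < g) (n : ℕ) (hn : s < n) :
    Subsingleton (Ext T (K.opcycles n) i) := by
  refine subsingleton_of_forall_eq 0 fun x => ?_
  have hS := opcyclesShortComplex_shortExact K n (h n hn)
  have := hT i hi (n + 1)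
  induction i generalizing n with
  | zero =>
    have := hS.mono_f
    exact ext_comp_injective_of_mono (K.fromOpcycles n (n + 1)) (Subsingleton.elim _ _)
  | succ i ih =>
    obtain ⟨z, rfl⟩ := Ext.covariant_sequence_exact₁ _ hS x
      (Subsingleton.elim (α := Ext T (K.X (n + 1)) (i + 1)) _ _) rfl
    have h0 : z = 0 := ih (by lia) (n + 1) (by lia) z
      (opcyclesShortComplex_shortExact K (n + 1) (h (n + 1) (by lia))) (hT i (by lia) _)
    rw [h0, Ext.zero_comp]

lemma exists_d_eq_of_pOpcycles_eq_zero (i j : ℕ) (hi : (ComplexShape.up ℕ).prev j = i)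
    (x : K.X j) (hx : (K.pOpcycles j).hom x = 0) : ∃ y, (K.d i j).hom y = x :=
  (ShortComplex.moduleCat_exact_iff _).1 (ShortComplex.exact_of_g_is_cokernel
    (ShortComplex.mk _ _ (K.d_pOpcycles i j)) (K.opcyclesIsCokernel i j hi)) x hx

lemma pOpcycles_surjective (n : ℕ) : Function.Surjective (K.pOpcycles n).hom :=
  (ModuleCat.epi_iff_surjective _).1 inferInstance

section FourTerm

variable {W A D Q : ModuleCat.{u} R} {ι : W ⟶ A} {f : A ⟶ D} {p : D ⟶ Q}

/-- For an exact sequence `0 ⟶ W ⟶ A ⟶ D ⟶ Q ⟶ 0`, the map from `A` to the kernel of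
`D ⟶ Q`. -/
def toKer (hp : Function.Exact f.hom p.hom) : A ⟶ ModuleCat.of R (LinearMap.ker p.hom) :=
  ModuleCat.ofHom (f.hom.codRestrict _ fun x => hp.apply_apply_eq_zero x)

lemma kernelShortExact (hι : Mono ι) (hf : Function.Exact ι.hom f.hom)
    (hp : Function.Exact f.hom p.hom) :
    ∃ h : ι ≫ toKer hp = 0, (ShortComplex.mk ι (toKer hp) h).ShortExact := by
  have hex : Function.Exact ι.hom (toKer hp).hom := fun x =>
    ⟨fun h => (hf x).1 congr(($h).1), fun h => Subtype.ext ((hf x).2 h)⟩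
  refine ⟨ModuleCat.hom_ext hex.linearMap_comp_eq_zero, ?_⟩
  exact
  { exact := ModuleCat.shortComplex_exact _ hex
    mono_f := hι
    epi_g := (ModuleCat.epi_iff_surjective _).2 fun ⟨x, hx⟩ => by
      obtain ⟨y, rfl⟩ := (hp x).1 hx
      exact ⟨y, rfl⟩ }

variable {m : ℕ}

lemma eq_zero_of_comp_subtype_eq_zero (hsurj : Function.Surjective p.hom)
    (hQ : ∀ i < m, Subsingleton (Ext T Q i))
    (y : Ext T (ModuleCat.of R (LinearMap.ker p.hom)) m)
    (hy : y.comp (Ext.mk₀ (ModuleCat.ofHom (LinearMap.ker p.hom).subtype)) (add_zero m) = 0) :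
    y = 0 := by
  have hS := LinearMap.shortExact_shortComplexKer hsurj
  cases m with
  | zero =>
    have := hS.mono_f
    exact ext_comp_injective_of_mono _ hy
  | succ m =>
    obtain ⟨z, rfl⟩ := Ext.covariant_sequence_exact₁ _ hS y hy rfl
    have := hQ m (by lia)
    rw [Subsingleton.elim (α := Ext T Q m) z 0, Ext.zero_comp]

/-- For `m > 0` the obstruction lies in `Ext^(m-1)(T, ker p)`, which embeds in `Ext^(m-1)(T, D) = 0`
since `Ext(T, Q)` vanishes one degree lower. The intended `W ⟶ A ⟶ D ⟶ Q` is `Ext^s(M, C) ⟶ K^s/B^s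
⟶ K^(s+1) ⟶ K^(s+1)/B^(s+1)`. -/
lemma eq_zero_of_comp_kernel_eq_zero (hι : Mono ι) (hf : Function.Exact ι.hom f.hom)
    (hp : Function.Exact f.hom p.hom) (hsurj : Function.Surjective p.hom)
    (hQ : ∀ i < m, Subsingleton (Ext T Q i)) (hD : ∀ i < m, Subsingleton (Ext T D i))
    (α : Ext T W m) (hα : α.comp (Ext.mk₀ ι) (add_zero m) = 0) : α = 0 := by
  cases m with
  | zero => exact ext_comp_injective_of_mono _ hα
  | succ m =>
    obtain ⟨_, hS⟩ := kernelShortExact hι hf hp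
    obtain ⟨z, rfl⟩ := Ext.covariant_sequence_exact₁ _ hS α hα rfl
    have := hD m (by lia)
    have h0 := eq_zero_of_comp_subtype_eq_zero hsurj (fun i hi => hQ i (by lia)) z
      (Subsingleton.elim (α := Ext T D m) _ _)
    rw [h0, Ext.zero_comp]

lemma exists_comp_kernel_eq (hι : Mono ι) (hf : Function.Exact ι.hom f.hom)
    (hp : Function.Exact f.hom p.hom) (hsurj : Function.Surjective p.hom)
    (hQ : ∀ i < m, Subsingleton (Ext T Q i)) (β : Ext T A m)
    (hβ : β.comp (Ext.mk₀ f) (add_zero m) = 0) :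
    ∃ α : Ext T W m, α.comp (Ext.mk₀ ι) (add_zero m) = β := by
  obtain ⟨_, hS⟩ := kernelShortExact hι hf hp
  refine Ext.covariant_sequence_exact₂ _ hS β (eq_zero_of_comp_subtype_eq_zero hsurj hQ _ ?_)
  rw [Ext.comp_assoc _ _ _ _ (add_zero 0) (by lia), Ext.mk₀_comp_mk₀]
  exact hβ

end FourTerm

lemma exact_fromOpcycles_pOpcycles (n : ℕ) :
    Function.Exact (K.fromOpcycles n (n + 1)).hom (K.pOpcycles (n + 1)).hom := by
  intro x
  constructor
  · intro hx
    obtain ⟨y, rfl⟩ := exists_d_eq_of_pOpcycles_eq_zero K n (n + 1) (by simp) x hx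
    exact ⟨(K.pOpcycles n).hom y, congr($(K.p_fromOpcycles n (n + 1)).hom y)⟩
  · rintro ⟨y, rfl⟩
    exact congr($((opcyclesShortComplex K n).zero).hom y)

end YonedaClass

/-! ### The duality `Ext^m(T, Ext^s(M, C)) ≅ Hom(M, Ext^(m+s)(T, C))` -/

section Biduality

variable {M : ModuleCat.{u} R} (P : ProjectiveResolution M) (C : ModuleCat.{u} R)

lemma extToOpcycles_injective (n : ℕ) : Function.Injective (extToOpcycles P C n) := by
  rw [injective_iff_map_eq_zero]
  intro e he
  obtain ⟨f, hf, rfl⟩ := P.extMk_surjective e (n + 1) rfl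
  rw [extToOpcycles_extMk] at he
  cases n with
  | zero =>
    -- By convention the predecessor of `0` is `0` itself, and the differential `d 0 0` is zero.
    obtain ⟨y, rfl⟩ := exists_d_eq_of_pOpcycles_eq_zero (dualComplex P C) 0 0 (by simp) f he
    have : ((dualComplex P C).d 0 0).hom y = 0 := by
      rw [HomologicalComplex.shape _ _ _ (by simp)]; rfl
    simp only [this]
    exact P.extMk_zero _ rfl
  | succ n =>
    exact (P.extMk_eq_zero_iff f _ rfl hf n rfl).2
      (exists_d_eq_of_pOpcycles_eq_zero (dualComplex P C) n (n + 1) (by simp) f he)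

lemma exact_extToOpcycles (n : ℕ) : Function.Exact (extToOpcycles P C n)
    ((dualComplex P C).fromOpcycles n (n + 1)).hom := by
  intro q
  constructor
  · intro hq
    obtain ⟨f, rfl⟩ := pOpcycles_surjective (dualComplex P C) n q
    have := congr($((dualComplex P C).p_fromOpcycles n (n + 1)).hom f)
    exact ⟨P.extMk f (n + 1) rfl (this.symm.trans hq), extToOpcycles_extMk ..⟩
  · rintro ⟨e, rfl⟩
    exact congr($(extToOpcycles_comp_fromOpcycles P C n).hom e)

lemma mono_extToOpcycles (n : ℕ) : Mono (Y := (dualComplex P C).opcycles n)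
    (ModuleCat.ofHom (extToOpcycles P C n)) :=
  (ModuleCat.mono_iff_injective _).2 (extToOpcycles_injective P C n)

instance (n : ℕ) : Module.Projective R (P.complex.X n) :=
  (IsProjective.iff_projective _).2 (P.projective n)

/-- The map `P_n ⟶ Ext^g(T, C)` sending `x` to the push-out of a class in `Ext^g(T, Hom(P_n, C))`
along evaluation at `x`. -/
def dualEval {T : ModuleCat.{u} R} {g n : ℕ} (β : Ext T ((dualComplex P C).X n) g) :
    P.complex.X n →ₗ[R] Ext T C g :=
  extEval (Q := P.complex.X n) β

lemma dualEval_apply {T : ModuleCat.{u} R} {g n : ℕ} (β : Ext T ((dualComplex P C).X n) g)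
    (x : P.complex.X n) :
    dualEval P C β x = β.comp (Ext.mk₀ (evalHom P C n x)) (add_zero g) := rfl

lemma dualEval_bijective (T : ModuleCat.{u} R) (g n : ℕ) :
    Function.Bijective (dualEval P C : Ext T ((dualComplex P C).X n) g → _) :=
  extEval_bijective (Q := P.complex.X n) g T

lemma eq_zero_of_dualEval_eq_zero {T : ModuleCat.{u} R} {g n : ℕ}
    {β : Ext T ((dualComplex P C).X n) g} (h : ∀ x, dualEval P C β x = 0) : β = 0 :=
  eq_zero_of_extEval_eq_zero (Q := P.complex.X n) h

variable {P C} {T : ModuleCat.{u} R} {m s g : ℕ}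

lemma subsingleton_ext_dualComplex (hT : ∀ i < g, Subsingleton (Ext T C i)) (i : ℕ) (hi : i < g)
    (n : ℕ) : Subsingleton (Ext T ((dualComplex P C).X n) i) :=
  subsingleton_ext_hom (Q := P.complex.X n) (hT i hi)

/-- Together with `exists_comp_universalClass_eq` this identifies `Ext^m(T, Ext^s(M, C))` with the
kernel of `Ext^g(T, Hom(P_0, C)) ⟶ Ext^g(T, Hom(P_1, C))`. By `dualEval_bijective` that kernel
consists of the maps `P_0 ⟶ Ext^g(T, C)` vanishing on the image of `P_1`, that is, of `Hom(M,
Ext^g(T, C))`. -/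
lemma eq_zero_of_comp_universalClass_eq_zero (hg : m + s = g)
    (hM : ∀ i < s, Subsingleton (Ext M C i))
    (hM' : m = 0 ∨ ∀ i > s, Subsingleton (Ext M C i))
    (hT : ∀ i < g, Subsingleton (Ext T C i)) (α : Ext T (ModuleCat.of R (Ext M C s)) m)
    (h : α.comp (universalClass P C s hM) hg = 0) : α = 0 := by
  have hT' := subsingleton_ext_dualComplex (P := P) hT
  have hK (i : ℕ) (hi : i < m) : Subsingleton (Ext T ((dualComplex P C).opcycles (s + 1)) i) :=
    subsingleton_ext_opcycles (dualComplex P C) hT' (fun n hn => dualComplex_exactAt P C n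
      (hM'.resolve_left (by lia) n hn)) i (by lia) (s + 1) (by lia)
  refine eq_zero_of_comp_kernel_eq_zero (mono_extToOpcycles P C s) (exact_extToOpcycles P C s)
    (exact_fromOpcycles_pOpcycles _ s) (pOpcycles_surjective _ (s + 1)) hK
    (fun i hi => hT' i (by lia) _) α ?_
  refine eq_zero_of_comp_yonedaClass_eq_zero (dualComplex P C) hT' s
    (fun i hi => dualComplex_exactAt P C i (hM i hi)) m hg.le hg _ ?_
  rw [Ext.comp_assoc _ _ _ _ (zero_add s) (by lia)]
  exact h

lemma exists_comp_universalClass_eq (hg : m + s = g)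
    (hM : ∀ i < s, Subsingleton (Ext M C i))
    (hM' : m = 0 ∨ ∀ i > s, Subsingleton (Ext M C i))
    (hT : ∀ i < g, Subsingleton (Ext T C i)) (β : Ext T ((dualComplex P C).opcycles 0) g)
    (hβ : β.comp (Ext.mk₀ ((dualComplex P C).fromOpcycles 0 1)) (add_zero g) = 0) :
    ∃ α : Ext T (ModuleCat.of R (Ext M C s)) m, α.comp (universalClass P C s hM) hg = β := by
  have hT' := subsingleton_ext_dualComplex (P := P) hT
  have hK (i : ℕ) (hi : i < m) : Subsingleton (Ext T ((dualComplex P C).opcycles (s + 1)) i) :=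
    subsingleton_ext_opcycles (dualComplex P C) hT' (fun n hn => dualComplex_exactAt P C n
      (hM'.resolve_left (by lia) n hn)) i (by lia) (s + 1) (by lia)
  obtain ⟨γ, hγ, rfl⟩ := exists_comp_yonedaClass_eq (dualComplex P C) hT' s
    (fun i hi => dualComplex_exactAt P C i (hM i hi)) m le_rfl hg β hβ
  obtain ⟨α, rfl⟩ := exists_comp_kernel_eq (mono_extToOpcycles P C s) (exact_extToOpcycles P C s)
    (exact_fromOpcycles_pOpcycles _ s) (pOpcycles_surjective _ (s + 1)) hK γ hγ
  exact ⟨α, (Ext.comp_assoc _ _ _ _ _ (by lia)).symm⟩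

lemma evalOpcycles_eq (x : P.complex.X 0) :
    evalOpcycles P C x = inv ((dualComplex P C).pOpcycles 0) ≫ evalHom P C 0 x := by
  rw [IsIso.eq_inv_comp, pOpcycles_evalOpcycles]

lemma comp_preBiduality (hg : m + s = g) (hM : ∀ i < s, Subsingleton (Ext M C i))
    (α : Ext T (ModuleCat.of R (Ext M C s)) m) (x : P.complex.X 0) :
    α.comp (preBiduality P C s hM x) hg =
      (α.comp (universalClass P C s hM) hg).comp (Ext.mk₀ (evalOpcycles P C x)) (add_zero g) :=
  (Ext.comp_assoc_of_third_deg_zero ..).symm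

lemma comp_evalOpcycles (β : Ext T ((dualComplex P C).opcycles 0) g) (x : P.complex.X 0) :
    β.comp (Ext.mk₀ (evalOpcycles P C x)) (add_zero g) =
      dualEval P C (β.comp (Ext.mk₀ (inv ((dualComplex P C).pOpcycles 0))) (add_zero g)) x := by
  rw [evalOpcycles_eq, dualEval_apply, ← Ext.mk₀_comp_mk₀, Ext.comp_assoc_of_third_deg_zero]

/-- If `Ext^i(T, C) = 0` for `i < m + s` and `Ext^i(M, C) = 0` for `i ≠ s`, a class in
`Ext^m(T, Ext^s(M, C))` is determined by its products with the elements of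
`Ext^s(Ext^s(M, C), C)` coming from `M`. For `m = 0` only `i < s` matters. -/
theorem eq_zero_of_comp_biduality_eq_zero (hg : m + s = g)
    (hM : ∀ i < s, Subsingleton (Ext M C i))
    (hM' : m = 0 ∨ ∀ i > s, Subsingleton (Ext M C i))
    (hT : ∀ i < g, Subsingleton (Ext T C i)) (α : Ext T (ModuleCat.of R (Ext M C s)) m)
    (h : ∀ x, α.comp (biduality C s hM x) hg = 0) : α = 0 := by
  let P := ProjectiveResolution.of M
  refine eq_zero_of_comp_universalClass_eq_zero (P := P) hg hM hM' hT α ?_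
  set β := α.comp (universalClass P C s hM) hg with hβ
  have h0 : β.comp (Ext.mk₀ (inv ((dualComplex P C).pOpcycles 0))) (add_zero g) = 0 :=
    eq_zero_of_dualEval_eq_zero P C fun x => by
      rw [← comp_evalOpcycles, hβ, ← comp_preBiduality, ← bidualityOfResolution_augmentation]
      exact h _
  have := congr($(h0).comp (Ext.mk₀ ((dualComplex P C).pOpcycles 0)) (add_zero g))
  rwa [Ext.comp_assoc_of_third_deg_zero, Ext.mk₀_comp_mk₀, IsIso.inv_hom_id, Ext.comp_mk₀_id,
    Ext.zero_comp] at this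

/-- If `Ext^i(T, C) = 0` for `i < m + s` and `Ext^i(M, C) = 0` for `i ≠ s`, every linear map
`M ⟶ Ext^(m+s)(T, C)` is given by multiplication with a class in `Ext^m(T, Ext^s(M, C))`.
For `m = 0` only `i < s` matters. -/
theorem exists_comp_biduality_eq (hg : m + s = g)
    (hM : ∀ i < s, Subsingleton (Ext M C i))
    (hM' : m = 0 ∨ ∀ i > s, Subsingleton (Ext M C i))
    (hT : ∀ i < g, Subsingleton (Ext T C i)) (l : M →ₗ[R] Ext T C g) :
    ∃ α : Ext T (ModuleCat.of R (Ext M C s)) m, ∀ x, α.comp (biduality C s hM x) hg = l x := by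
  let P := ProjectiveResolution.of M
  -- The class `γ` represents `l` pulled back to `P_0`. It dies in `Hom(P_1, C)` because the
  -- augmentation kills the image of `P_1`.
  obtain ⟨γ, hγ⟩ := (dualEval_bijective P C T g 0).2 (l ∘ₗ augmentation P)
  obtain ⟨α, hα⟩ := exists_comp_universalClass_eq (P := P) hg hM hM' hT
    (γ.comp (Ext.mk₀ ((dualComplex P C).pOpcycles 0)) (add_zero g)) (by
      rw [Ext.comp_assoc_of_third_deg_zero, Ext.mk₀_comp_mk₀, HomologicalComplex.p_fromOpcycles]
      refine eq_zero_of_dualEval_eq_zero P C fun y => ?_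
      rw [dualEval_apply, Ext.comp_assoc_of_third_deg_zero]
      have : augmentation P ((P.complex.d 1 0).hom y) = 0 :=
        congr($(P.complex_d_comp_π_f_zero).hom y)
      refine Eq.trans ?_ ((LinearMap.congr_fun hγ ((P.complex.d 1 0).hom y)).trans
        ((congrArg l this).trans (map_zero l)))
      rw [dualEval_apply, Ext.mk₀_comp_mk₀, evalHom_d])
  refine ⟨α, fun x => ?_⟩
  obtain ⟨y, rfl⟩ := augmentation_surjective P x
  change α.comp (bidualityOfResolution P C s hM _) hg = _
  rw [bidualityOfResolution_augmentation, comp_preBiduality, hα, comp_evalOpcycles,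
    Ext.comp_assoc_of_third_deg_zero, Ext.mk₀_comp_mk₀, IsIso.hom_inv_id, Ext.comp_mk₀_id]
  exact LinearMap.congr_fun hγ y

end Biduality


/-! ### Naturality of the biduality map -/

section Naturality

lemma yonedaClass_naturality {K L : CochainComplex (ModuleCat.{u} R) ℕ} (φ : K ⟶ L) (n : ℕ)
    (hK : ∀ i < n, K.ExactAt i) (hL : ∀ i < n, L.ExactAt i) :
    (yonedaClass K n hK).comp (Ext.mk₀ (HomologicalComplex.opcyclesMap φ 0)) (add_zero n) =
      (Ext.mk₀ (HomologicalComplex.opcyclesMap φ n)).comp (yonedaClass L n hL) (zero_add n) := by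
  induction n with
  | zero => simp [yonedaClass]
  | succ n ih =>
    let ψ : opcyclesShortComplex K n ⟶ opcyclesShortComplex L n :=
      { τ₁ := HomologicalComplex.opcyclesMap φ n
        τ₂ := φ.f (n + 1)
        τ₃ := HomologicalComplex.opcyclesMap φ (n + 1)
        comm₁₂ := by
          rw [← cancel_epi (K.pOpcycles n)]
          simp
        comm₂₃ := by simp }
    have hψ := ShortComplex.ShortExact.extClass_naturality
      (opcyclesShortComplex_shortExact K n (hK n n.lt_succ_self))
      (opcyclesShortComplex_shortExact L n (hL n n.lt_succ_self)) ψ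
    rw [yonedaClass, yonedaClass, Ext.comp_assoc_of_third_deg_zero,
      ih _ (fun i hi => hL i (hi.trans n.lt_succ_self)),
      ← Ext.comp_assoc _ _ _ (zero_add 1) _ (by lia), ← hψ,
      Ext.comp_assoc _ _ _ _ (zero_add n) (by lia)]

variable {X Y C : ModuleCat.{u} R}

/-- The map `Ext^n(Y, C) ⟶ Ext^n(X, C)` induced by `f : X ⟶ Y`. -/
def extMap (f : X ⟶ Y) (C : ModuleCat.{u} R) (n : ℕ) : Ext Y C n →ₗ[R] Ext X C n :=
  (Ext.mk₀ f).precompOfLinear R C (zero_add n)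

lemma extMap_apply (f : X ⟶ Y) (n : ℕ) (α : Ext Y C n) :
    extMap f C n α = (Ext.mk₀ f).comp α (zero_add n) := rfl

variable {P : ProjectiveResolution X} {Q : ProjectiveResolution Y} {f : X ⟶ Y}

/-- The map `Hom(Q, C) ⟶ Hom(P, C)` induced by a map of resolutions. -/
def dualComplexMap (φ : ProjectiveResolution.Hom P Q f) (C : ModuleCat.{u} R) :
    dualComplex Q C ⟶ dualComplex P C where
  f i := ModuleCat.ofHom (X := (Q.complex.X i ⟶ C)) (Y := (P.complex.X i ⟶ C))
    (Linear.leftComp R C (φ.hom.f i))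
  comm' i j _ := by
    apply ModuleCat.hom_ext
    apply LinearMap.ext
    intro (g : Q.complex.X i ⟶ C)
    change P.complex.d j i ≫ φ.hom.f i ≫ g = φ.hom.f j ≫ Q.complex.d j i ≫ g
    rw [φ.hom.comm_assoc]

lemma toOpcycles_naturality (φ : ProjectiveResolution.Hom P Q f) (n : ℕ)
    (g : Q.complex.X n ⟶ C) :
    toOpcycles P C n (φ.hom.f n ≫ g) =
      (HomologicalComplex.opcyclesMap (dualComplexMap φ C) n).hom (toOpcycles Q C n g) :=
  congr($(HomologicalComplex.p_opcyclesMap (dualComplexMap φ C) n).hom g).symm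

lemma extToOpcycles_naturality (φ : ProjectiveResolution.Hom P Q f) (n : ℕ) :
    ModuleCat.ofHom (extMap f C n) ≫ ModuleCat.ofHom (extToOpcycles P C n) =
      ModuleCat.ofHom (extToOpcycles Q C n) ≫
        HomologicalComplex.opcyclesMap (dualComplexMap φ C) n := by
  apply ModuleCat.hom_ext
  apply LinearMap.ext
  intro (e : Ext Y C n)
  obtain ⟨g, hg, rfl⟩ := Q.extMk_surjective e (n + 1) rfl
  change extToOpcycles P C n (extMap f C n _) =
    (HomologicalComplex.opcyclesMap (dualComplexMap φ C) n).hom (extToOpcycles Q C n _)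
  rw [extMap_apply, ProjectiveResolution.mk₀_comp_extMk _ _ _ _ φ, extToOpcycles_extMk,
    extToOpcycles_extMk, toOpcycles_naturality]

lemma universalClass_naturality (φ : ProjectiveResolution.Hom P Q f) (s : ℕ)
    (hX : ∀ i < s, Subsingleton (Ext X C i)) (hY : ∀ i < s, Subsingleton (Ext Y C i)) :
    (universalClass Q C s hY).comp
      (Ext.mk₀ (HomologicalComplex.opcyclesMap (dualComplexMap φ C) 0)) (add_zero s) =
      (Ext.mk₀ (ModuleCat.ofHom (extMap f C s))).comp (universalClass P C s hX) (zero_add s) := by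
  rw [universalClass, universalClass, Ext.comp_assoc_of_third_deg_zero, yonedaClass_naturality,
    Ext.mk₀_comp_mk₀_assoc, Ext.mk₀_comp_mk₀_assoc, extToOpcycles_naturality φ]

lemma evalOpcycles_naturality (φ : ProjectiveResolution.Hom P Q f) (x : P.complex.X 0) :
    evalOpcycles Q C ((φ.hom.f 0).hom x) =
      HomologicalComplex.opcyclesMap (dualComplexMap φ C) 0 ≫ evalOpcycles P C x := by
  rw [← cancel_epi ((dualComplex Q C).pOpcycles 0), pOpcycles_evalOpcycles,
    HomologicalComplex.p_opcyclesMap_assoc, pOpcycles_evalOpcycles]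
  rfl

/-- A lift of `f` to the resolutions induces a map of dual complexes, and every ingredient of the
universal class is natural for it. -/
theorem biduality_naturality (f : X ⟶ Y) (s : ℕ)
    (hX : ∀ i < s, Subsingleton (Ext X C i)) (hY : ∀ i < s, Subsingleton (Ext Y C i)) (x : X) :
    biduality C s hY (f.hom x) =
      (Ext.mk₀ (ModuleCat.ofHom (extMap f C s))).comp (biduality C s hX x) (zero_add s) := by
  let P := ProjectiveResolution.of X
  let Q := ProjectiveResolution.of Y
  let φ : ProjectiveResolution.Hom P Q f :=
    { hom := ProjectiveResolution.lift f P Q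
      hom_f_zero_comp_π_f_zero := ProjectiveResolution.lift_commutes_zero f P Q }
  obtain ⟨y, rfl⟩ := augmentation_surjective P x
  have hφ : f.hom (augmentation P y) = augmentation Q ((φ.hom.f 0).hom y) :=
    congr($(φ.hom_f_zero_comp_π_f_zero).hom y).symm
  rw [hφ]
  change bidualityOfResolution Q C s hY _ =
    (Ext.mk₀ _).comp (bidualityOfResolution P C s hX _) (zero_add s)
  rw [bidualityOfResolution_augmentation, bidualityOfResolution_augmentation]
  change (universalClass Q C s hY).comp (Ext.mk₀ (evalOpcycles Q C _)) (add_zero s) =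
    (Ext.mk₀ _).comp ((universalClass P C s hX).comp (Ext.mk₀ (evalOpcycles P C y)) (add_zero s))
      (zero_add s)
  rw [evalOpcycles_naturality, ← Ext.mk₀_comp_mk₀, ← Ext.comp_assoc_of_third_deg_zero,
    universalClass_naturality φ s hX hY, Ext.comp_assoc_of_third_deg_zero]

end Naturality


/-! ### Nonzero maps and vanishing of Ext -/

section Vanishing

/-- If `Hom(X, V) = 0`, then some element of the annihilator of `X` is regular on `V`; here it would
also annihilate `V ≠ 0`. -/
lemma exists_linearMap_ne_zero [IsNoetherianRing R] {X V : Type u} [AddCommGroup X] [Module R X]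
    [AddCommGroup V] [Module R V] [Module.Finite R X] [Module.Finite R V] [Nontrivial V]
    (h : Module.annihilator R X ≤ Module.annihilator R V) : ∃ l : X →ₗ[R] V, l ≠ 0 := by
  by_contra! hl
  obtain ⟨r, hr, hreg⟩ := IsSMulRegular.subsingleton_linearMap_iff.1
    (subsingleton_of_forall_eq (0 : X →ₗ[R] V) hl)
  obtain ⟨v, hv⟩ := exists_ne (0 : V)
  exact hv (hreg ((Module.mem_annihilator.1 (h hr) v).trans (smul_zero r).symm))

lemma annihilator_le_annihilator_ext (X Y : ModuleCat.{u} R) (i : ℕ) :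
    Module.annihilator R X ≤ Module.annihilator R (Ext X Y i) := by
  intro r hr
  refine Module.mem_annihilator.2 fun e => ?_
  have h : r • 𝟙 X = 0 := by
    ext x
    exact Module.mem_annihilator.1 hr x
  rw [← Ext.mk₀_id_comp e, ← Ext.smul_comp, ← Ext.mk₀_smul, h, Ext.mk₀_zero, Ext.zero_comp]

lemma subsingleton_ext_of_subsingleton_left {X : ModuleCat.{u} R} (Y : ModuleCat.{u} R) (i : ℕ)
    (h : Subsingleton X) : Subsingleton (Ext X Y i) := by
  refine subsingleton_of_forall_eq 0 fun e => ?_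
  rw [← Ext.mk₀_id_comp e, (ModuleCat.isZero_of_subsingleton X).eq_of_src (𝟙 X) 0, Ext.mk₀_zero,
    Ext.zero_comp]

lemma subsingleton_ext_of_subsingleton_right (X : ModuleCat.{u} R) {Y : ModuleCat.{u} R} (i : ℕ)
    (h : Subsingleton Y) : Subsingleton (Ext X Y i) := by
  refine subsingleton_of_forall_eq 0 fun e => ?_
  rw [← Ext.comp_mk₀_id e, (ModuleCat.isZero_of_subsingleton Y).eq_of_src (𝟙 Y) 0, Ext.mk₀_zero,
    Ext.comp_zero]

lemma subsingleton_ext_of_iso {T X Y : ModuleCat.{u} R} (e : X ≅ Y) {i : ℕ}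
    (h : Subsingleton (Ext T X i)) : Subsingleton (Ext T Y i) := by
  refine subsingleton_of_forall_eq 0 fun x => ?_
  rw [← Ext.comp_mk₀_id x, ← e.inv_hom_id, ← Ext.mk₀_comp_mk₀, ← Ext.comp_assoc_of_third_deg_zero,
    Subsingleton.elim (x.comp (Ext.mk₀ e.inv) (add_zero i)) 0, Ext.zero_comp]

/-- If `Ext^i(X, C) = 0` for `i ≤ g` and `Ext^i(T, C) = 0` for `i < g`, then
`Hom(X, Ext^g(T, C)) = 0`. -/
lemma linearMap_ext_eq_zero {X T C : ModuleCat.{u} R} {g : ℕ}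
    (hX : ∀ i ≤ g, Subsingleton (Ext X C i)) (hT : ∀ i < g, Subsingleton (Ext T C i))
    (l : X →ₗ[R] Ext T C g) : l = 0 := by
  -- The duality with `m = 0` places `l` in `Hom(T, Ext^g(X, C))`, which is zero.
  obtain ⟨α, hα⟩ := exists_comp_biduality_eq (zero_add g) (fun i hi => hX i hi.le) (.inl rfl) hT l
  have := subsingleton_ext_of_subsingleton_right T 0
    (Y := ModuleCat.of R (Ext X C g)) (hX g le_rfl)
  ext x
  rw [← hα, Subsingleton.elim α 0, Ext.zero_comp, LinearMap.zero_apply]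

/-- At the first `i < s` where this Ext is nonzero, it is killed by the annihilator of `X`, so `X`
maps to it nontrivially. This contradicts `linearMap_ext_eq_zero`. -/
lemma subsingleton_ext_ext [IsNoetherianRing R] {X C : ModuleCat.{u} R} [Module.Finite R X]
    [Module.Finite R C] {s : ℕ} (hX : ∀ i < s, Subsingleton (Ext X C i)) (i : ℕ) (hi : i < s) :
    Subsingleton (Ext (ModuleCat.of R (Ext X C s)) C i) := by
  induction i using Nat.strong_induction_on with
  | _ i ih =>
    by_contra hn
    rw [not_subsingleton_iff_nontrivial] at hn
    obtain ⟨l, hl⟩ := exists_linearMap_ne_zero ((annihilator_le_annihilator_ext X C s).trans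
      (annihilator_le_annihilator_ext (ModuleCat.of R (Ext X C s)) C i))
    exact hl (linearMap_ext_eq_zero (fun k hk => hX k (by lia)) (fun k hk => ih k hk (by lia)) l)

end Vanishing

/-! ### Depth as the first nonvanishing Ext from the residue field -/

section Depth

/-- The smallest `i` with `Ext^i(T, M) ≠ 0` is `a`. -/
def HasExtGrade (T M : ModuleCat.{u} R) (a : ℕ) : Prop :=
  (∀ i < a, Subsingleton (Ext T M i)) ∧ Nontrivial (Ext T M a)

lemma HasExtGrade.of_iso {T X Y : ModuleCat.{u} R} {a : ℕ} (h : HasExtGrade T X a) (e : X ≅ Y) :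
    HasExtGrade T Y a := by
  refine ⟨fun i hi => subsingleton_ext_of_iso e (h.1 i hi), ?_⟩
  by_contra hn
  exact not_subsingleton_iff_nontrivial.2 h.2
    (subsingleton_ext_of_iso e.symm (not_nontrivial_iff_subsingleton.1 hn))

/-- If `Ext^i(X, C) = 0` for `i ≠ s`, if `e + s` is the smallest `i` with `Ext^i(T, C) ≠ 0`, and if
`Hom(X, Ext^(e + s)(T, C)) ≠ 0`, then `e` is the smallest `i` with `Ext^i(T, Ext^s(X, C)) ≠ 0`. -/
theorem HasExtGrade.ext {T X C : ModuleCat.{u} R} {s e : ℕ} (hC : HasExtGrade T C (e + s))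
    (hlt : ∀ i < s, Subsingleton (Ext X C i)) (hgt : ∀ i > s, Subsingleton (Ext X C i))
    (l : X →ₗ[R] Ext T C (e + s)) (hl : l ≠ 0) :
    HasExtGrade T (ModuleCat.of R (Ext X C s)) e := by
  constructor
  · refine fun m hm => subsingleton_of_forall_eq 0 fun α => ?_
    refine eq_zero_of_comp_biduality_eq_zero rfl hlt (.inr hgt)
      (fun i hi => hC.1 i (by lia)) α fun x => ?_
    have := hC.1 (m + s) (by lia)
    exact Subsingleton.elim _ _
  · obtain ⟨α, hα⟩ := exists_comp_biduality_eq rfl hlt (.inr hgt) hC.1 l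
    refine nontrivial_of_ne α 0 ?_
    rintro rfl
    refine hl (LinearMap.ext fun x => ?_)
    rw [← hα, Ext.zero_comp, LinearMap.zero_apply]

variable [IsLocalRing R]

variable (R) in
/-- The residue field of `R`. -/
abbrev residueModule : ModuleCat.{u} R := ModuleCat.of R (R ⧸ IsLocalRing.maximalIdeal R)

/-- The annihilator of `X ≠ 0` lies in the maximal ideal, which kills `k`. With
`exists_linearMap_ne_zero` this provides nonzero maps from `X` to a nonzero `Ext^i(k, Y)`. -/
lemma annihilator_le_annihilator_ext_residueModule (X : Type u) [AddCommGroup X] [Module R X]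
    [Nontrivial X] (Y : ModuleCat.{u} R) (i : ℕ) :
    Module.annihilator R X ≤ Module.annihilator R (Ext (residueModule R) Y i) := by
  refine le_trans ?_ (annihilator_le_annihilator_ext _ Y i)
  rw [Ideal.annihilator_quotient]
  exact IsLocalRing.le_maximalIdeal fun h =>
    not_subsingleton X (Module.annihilator_eq_top_iff.1 h)

variable [IsNoetherianRing R]

omit [IsNoetherianRing R] in
lemma maximalIdeal_smul_lt (M : ModuleCat.{u} R) [Module.Finite R M] [Nontrivial M] :
    IsLocalRing.maximalIdeal R • (⊤ : Submodule R M) < ⊤ :=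
  lt_top_iff_ne_top.2 (Submodule.top_ne_ideal_smul_of_le_jacobson_annihilator
    (IsLocalRing.maximalIdeal_le_jacobson _)).symm

omit [IsNoetherianRing R] in
lemma support_residueModule : Module.support R (residueModule R) =
    PrimeSpectrum.zeroLocus (IsLocalRing.maximalIdeal R) := by
  rw [Module.support_eq_zeroLocus, Ideal.annihilator_quotient]

/-- Rees' theorem: a regular sequence longer than `a` would kill `Ext^a(k, M)`, and vanishing below
`a` yields one of length `a`. -/
lemma HasExtGrade.depth_eq {M : ModuleCat.{u} R} [Module.Finite R M] [Nontrivial M] {a : ℕ}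
    (h : HasExtGrade (residueModule R) M a) : depth M = a := by
  apply le_antisymm
  · refine iSup₂_le fun rs hrs => ?_
    by_contra hlt
    have hlt : a < rs.length := by simpa using hlt
    exact not_subsingleton_iff_nontrivial.2 h.2
      (ModuleCat.subsingleton_ext_of_exists_isRegular (IsLocalRing.maximalIdeal R)
        (residueModule R) support_residueModule.le M (maximalIdeal_smul_lt M) rs hrs.1 hrs.2 a hlt)
  · obtain ⟨rs, rfl, hrs⟩ := ModuleCat.exists_isRegular_of_exists_subsingleton_ext
      (IsLocalRing.maximalIdeal R) a M (maximalIdeal_smul_lt M) (residueModule R)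
      support_residueModule h.1
    exact le_iSup₂_of_le rs hrs le_rfl

/-- If every `Ext^a(k, M)` vanished, there would be an `M`-regular sequence of length `dim R + 1`,
while each of its terms lowers the dimension of the support by one. -/
lemma exists_hasExtGrade (M : ModuleCat.{u} R) [Module.Finite R M] [Nontrivial M] :
    ∃ a, HasExtGrade (residueModule R) M a := by
  classical
  have hex : ∃ a, Nontrivial (Ext (residueModule R) M a) := by
    by_contra! h
    obtain ⟨e, he⟩ := WithBot.ne_bot_iff_exists.1 (ringKrullDim_ne_bot (R := R))
    have he' : e ≠ ⊤ := by
      rintro rfl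
      exact ringKrullDim_ne_top (R := R) he.symm
    lift e to ℕ using he'
    obtain ⟨rs, hlen, hrs⟩ := ModuleCat.exists_isRegular_of_exists_subsingleton_ext
      (IsLocalRing.maximalIdeal R) (e + 1) M (maximalIdeal_smul_lt M) (residueModule R)
      support_residueModule fun i _ => h i
    have hdim := Module.supportDim_add_length_eq_supportDim_of_isRegular rs hrs.2
    have : Nontrivial (M ⧸ (Ideal.ofList rs • ⊤ : Submodule R M)) :=
      Submodule.Quotient.nontrivial_iff.2 hrs.2.top_ne_smul.symm
    obtain ⟨b, hb⟩ := WithBot.ne_bot_iff_exists.1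
      (Module.supportDim_ne_bot_of_nontrivial R (M ⧸ (Ideal.ofList rs • ⊤ : Submodule R M)))
    have hle := hdim.trans_le (Module.supportDim_le_ringKrullDim R M)
    rw [← hb, ← he, hlen] at hle
    have hle' : b + ((e + 1 : ℕ) : ℕ∞) ≤ (e : ℕ∞) := WithBot.coe_le_coe.1 hle
    have := Nat.cast_le.1 (le_add_self.trans hle')
    lia
  exact ⟨Nat.find hex, fun i hi => not_nontrivial_iff_subsingleton.1 (Nat.find_min hex hi),
    Nat.find_spec hex⟩

/-- For a nonzero finitely generated module `X` with `Ext^i(X, C) = 0` for `i ≠ s`, the depth of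
`Ext^s(X, C)` is `depth C - s`. -/
theorem HasExtGrade.exists_ext {X C : ModuleCat.{u} R} [Module.Finite R X] [Module.Finite R C]
    [Nontrivial X] {s d : ℕ} (hC : HasExtGrade (residueModule R) C d)
    (hlt : ∀ i < s, Subsingleton (Ext X C i)) (hgt : ∀ i > s, Subsingleton (Ext X C i)) :
    ∃ e, d = e + s ∧ HasExtGrade (residueModule R) (ModuleCat.of R (Ext X C s)) e := by
  have := hC.2
  obtain ⟨l, hl⟩ := exists_linearMap_ne_zero
    (annihilator_le_annihilator_ext_residueModule X C d)
  have hsd : s ≤ d := by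
    by_contra! h
    exact hl (linearMap_ext_eq_zero (fun i hi => hlt i (by lia)) hC.1 l)
  obtain ⟨e, rfl⟩ := Nat.exists_eq_add_of_le' hsd
  exact ⟨e, rfl, hC.ext hlt hgt l hl⟩

end Depth

/-! ### Comparing `C` with `R` -/

section Semidualizing

variable {C : ModuleCat.{u} R}

/-- For `C` semidualizing, `Ext^0(C, C)` is `R`. -/
def IsSemidualizing.isoExtZero (hC : IsSemidualizing C) :
    ModuleCat.of R (Ext C C 0) ≅ ModuleCat.of R R :=
  ((Ext.linearEquiv₀ (R := R)).trans (ModuleCat.homLinearEquiv.trans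
    (LinearEquiv.ofBijective (Algebra.linearMap R (Module.End R C))
      hC.homothety_bijective).symm)).toModuleIso

lemma IsSemidualizing.nontrivial [Nontrivial R] (hC : IsSemidualizing C) : Nontrivial C := by
  by_contra h
  rw [not_nontrivial_iff_subsingleton] at h
  exact not_subsingleton R hC.homothety_bijective.1.subsingleton

lemma IsSemidualizing.annihilator_eq_bot (hC : IsSemidualizing C) :
    Module.annihilator R C = ⊥ := by
  refine (Submodule.eq_bot_iff _).2 fun r hr => hC.homothety_bijective.1 ?_
  ext x
  rw [map_zero, Module.algebraMap_end_apply, LinearMap.zero_apply]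
  exact Module.mem_annihilator.1 hr x

/-- This is the duality with `X = C` and `s = 0`, where `Ext^0(C, C) ≅ R`; the required nonzero map
exists because `C` is faithful. For `T = k` it gives `depth R = depth C`; for general `T` it lets
the grade be computed with `C`. -/
lemma IsSemidualizing.hasExtGrade_self [IsNoetherianRing R] (hC : IsSemidualizing C)
    {T : ModuleCat.{u} R} [Module.Finite R T] {a : ℕ} (h : HasExtGrade T C a) :
    HasExtGrade T (ModuleCat.of R R) a := by
  have := hC.finite
  have := h.2
  obtain ⟨l, hl⟩ := exists_linearMap_ne_zero (X := C) (V := Ext T C a)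
    (hC.annihilator_eq_bot.trans_le bot_le)
  exact (HasExtGrade.ext (s := 0) (e := a) h (by simp) hC.ext_self l hl).of_iso hC.isoExtZero

end Semidualizing


/-! ### Grade, and modules of `G_C^j`-dimension zero -/

lemma le_grade_iff {M : ModuleCat.{u} R} {j : ℕ} :
    j ≤ grade M ↔ ∀ i < j, Subsingleton (Ext M (ModuleCat.of R R) i) := by
  simp only [grade, le_iInf_iff, Nat.cast_le]
  exact forall_congr' fun i => by rw [← not_nontrivial_iff_subsingleton, ← not_lt, imp_not_comm]

lemma grade_eq_of_hasExtGrade {M : ModuleCat.{u} R} {j : ℕ}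
    (h : HasExtGrade M (ModuleCat.of R R) j) : grade M = j :=
  le_antisymm (iInf₂_le j h.2) (le_grade_iff.2 h.1)

namespace IsGCDimZero

variable {C X : ModuleCat.{u} R} {j : ℕ}

lemma nontrivial (h : IsGCDimZero C j X) : Nontrivial X := by
  by_contra hX
  rw [not_nontrivial_iff_subsingleton] at hX
  have := le_grade_iff.2 fun i (_ : i < j + 1) =>
    subsingleton_ext_of_subsingleton_left (X := X) (ModuleCat.of R R) i hX
  rw [h.grade_eq, Nat.cast_le] at this
  lia

/-- The biduality isomorphism of a module of `G_C^j`-dimension zero. -/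
def iso (h : IsGCDimZero C j X) :
    X ≅ ModuleCat.of R (Ext (ModuleCat.of R (Ext X C j)) C j) :=
  (LinearEquiv.ofBijective _ h.biduality_bijective).toModuleIso

lemma nontrivial_ext (h : IsGCDimZero C j X) : Nontrivial (Ext X C j) := by
  have := h.nontrivial
  have := h.biduality_bijective.1.nontrivial
  by_contra hX
  rw [not_nontrivial_iff_subsingleton] at hX
  exact not_subsingleton _ (subsingleton_ext_of_subsingleton_left
    (X := ModuleCat.of R (Ext X C j)) C j hX)

lemma subsingleton_ext_ext (h : IsGCDimZero C j X) (i : ℕ) (hi : j < i) :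
    Subsingleton (Ext (ModuleCat.of R (Ext X C j)) C i) := by
  obtain ⟨k, rfl⟩ := Nat.exists_eq_add_of_lt hi
  exact h.ext_ext_gt (k + 1) (by lia)

/-- The depth formula is applied to the dual `Ext^j(X, C)`, whose Ext into `C` is concentrated in
degree `j` and there returns `X`. The depth therefore does not depend on `X`. -/
lemma hasExtGrade [IsNoetherianRing R] [IsLocalRing R] (h : IsGCDimZero C j X) [Module.Finite R C]
    {d : ℕ} (hC : HasExtGrade (residueModule R) C d) :
    ∃ e, d = e + j ∧ HasExtGrade (residueModule R) X e := by
  have := h.finite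
  have := h.nontrivial_ext
  obtain ⟨e, rfl, he⟩ := HasExtGrade.exists_ext (X := ModuleCat.of R (Ext X C j)) (s := j) hC
    (IntermediateGorenstein.subsingleton_ext_ext h.ext_lt) h.subsingleton_ext_ext
  exact ⟨e, rfl, he.of_iso h.iso.symm⟩

end IsGCDimZero

/-! ### Short exact sequences with two terms of `G_C^j`-dimension zero -/

section ShortExact

variable {S : ShortComplex (ModuleCat.{u} R)} (hS : S.ShortExact) {C : ModuleCat.{u} R} {j : ℕ}

include hS in
lemma subsingleton_ext_X₃ (Y : ModuleCat.{u} R) (h₁ : ∀ i < j, Subsingleton (Ext S.X₁ Y i))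
    (h₂ : ∀ i < j, Subsingleton (Ext S.X₂ Y i)) (i : ℕ) (hi : i < j) :
    Subsingleton (Ext S.X₃ Y i) := by
  refine subsingleton_of_forall_eq 0 fun x => ?_
  have := h₂ i hi
  have hx : (Ext.mk₀ S.g).comp x (zero_add i) = 0 := Subsingleton.elim _ _
  cases i with
  | zero =>
    have := hS.epi_g
    exact Ext.precomp_mk₀_injective_of_epi Y S.g
      (hx.trans (Ext.comp_zero (m := 0) (Ext.mk₀ S.g) Y 0 (zero_add 0)).symm)
  | succ i =>
    obtain ⟨z, rfl⟩ := Ext.contravariant_sequence_exact₃ hS _ x hx (add_comm 1 i)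
    have := h₁ i (by lia)
    rw [Subsingleton.elim z 0, Ext.comp_zero]

include hS in
lemma extMap_g_injective (h₁ : ∀ i < j, Subsingleton (Ext S.X₁ C i)) :
    Function.Injective (extMap S.g C j) := by
  rw [injective_iff_map_eq_zero]
  intro x hx
  cases j with
  | zero =>
    have := hS.epi_g
    exact Ext.precomp_mk₀_injective_of_epi C S.g
      (hx.trans (Ext.comp_zero (m := 0) (Ext.mk₀ S.g) C 0 (zero_add 0)).symm)
  | succ i =>
    obtain ⟨z, rfl⟩ := Ext.contravariant_sequence_exact₃ hS _ x hx (add_comm 1 i)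
    have := h₁ i (by lia)
    rw [Subsingleton.elim z 0, Ext.comp_zero]

include hS in
/-- The sequence `0 ⟶ Ext^j(X₃, C) ⟶ Ext^j(X₂, C) ⟶ Ext^j(X₁, C) ⟶ 0`. -/
lemma ext_shortExact (h₁ : ∀ i < j, Subsingleton (Ext S.X₁ C i))
    (hsurj : Function.Surjective (extMap S.f C j)) :
    ∃ h : ModuleCat.ofHom (extMap S.g C j) ≫ ModuleCat.ofHom (extMap S.f C j) = 0,
      (ShortComplex.mk _ _ h).ShortExact := by
  have hex : Function.Exact (extMap S.g C j) (extMap S.f C j) := fun x => by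
    constructor
    · exact fun hx => Ext.contravariant_sequence_exact₂ hS C x hx
    · rintro ⟨y, rfl⟩
      rw [extMap_apply, extMap_apply, Ext.mk₀_comp_mk₀_assoc, S.zero, Ext.mk₀_zero, Ext.zero_comp]
  refine ⟨ModuleCat.hom_ext hex.linearMap_comp_eq_zero, ?_⟩
  exact
  { exact := ModuleCat.shortComplex_exact _ hex
    mono_f := (ModuleCat.mono_iff_injective _).2 (extMap_g_injective hS h₁)
    epi_g := (ModuleCat.epi_iff_surjective _).2 hsurj }

include hS in
lemma subsingleton_ext_X₃_of_surjective (h₁ : IsGCDimZero C j S.X₁) (h₂ : IsGCDimZero C j S.X₂)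
    (hsurj : Function.Surjective (extMap S.f C j)) (i : ℕ) (hi : i > 0) :
    Subsingleton (Ext S.X₃ C (j + i)) := by
  obtain ⟨i, rfl⟩ := Nat.exists_eq_add_of_lt hi
  refine subsingleton_of_forall_eq 0 fun x => ?_
  have := h₂.ext_gt (0 + i + 1) (by lia)
  obtain ⟨z, rfl⟩ := Ext.contravariant_sequence_exact₃ hS _ x (Subsingleton.elim _ _)
    (n₀ := j + i) (by lia)
  cases i with
  -- Surjectivity enters only here: `Ext^(j+1)(X₃, C)` is the cokernel of `Ext^j(X₂, C) ⟶ Ext^j(X₁,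
  -- C)`.
  | zero =>
    obtain ⟨y, rfl⟩ := hsurj z
    exact hS.extClass_comp_assoc y
  | succ i =>
    have := h₁.ext_gt (i + 1) (by lia)
    rw [Subsingleton.elim z 0, Ext.comp_zero]

include hS in
-- A five lemma argument between the given sequence and its double dual; exactness at the right end
-- of the latter comes from `Ext^(j+1)(Ext^j(X₁, C), C) = 0`.
lemma biduality_X₃_bijective (h₁ : IsGCDimZero C j S.X₁) (h₂ : IsGCDimZero C j S.X₂)
    (hsurj : Function.Surjective (extMap S.f C j)) (h₃ : ∀ i < j, Subsingleton (Ext S.X₃ C i)) :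
    Function.Bijective (biduality C j h₃) := by
  obtain ⟨_, hE⟩ := ext_shortExact hS h₁.ext_lt hsurj
  constructor
  · rw [injective_iff_map_eq_zero]
    intro x hx
    obtain ⟨y, rfl⟩ := (ModuleCat.epi_iff_surjective S.g).1 hS.epi_g x
    rw [biduality_naturality S.g j h₂.ext_lt h₃] at hx
    obtain ⟨w, hw⟩ := Ext.contravariant_sequence_exact₂ hE C _ hx
    obtain ⟨x₁, rfl⟩ := h₁.biduality_bijective.2 w
    have hy : S.f.hom x₁ = y := h₂.biduality_bijective.1 <| by
      rw [biduality_naturality S.f j h₁.ext_lt h₂.ext_lt]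
      exact hw
    rw [← hy]
    exact congr($(S.zero).hom x₁)
  · intro z
    have := h₁.ext_ext_gt 1 one_pos
    obtain ⟨w, hw⟩ := Ext.contravariant_sequence_exact₁ hE C z (add_comm 1 j)
      (Subsingleton.elim (α := Ext (ModuleCat.of R (Ext S.X₁ C j)) C (j + 1)) _ _)
    obtain ⟨y, rfl⟩ := h₂.biduality_bijective.2 w
    refine ⟨S.g.hom y, ?_⟩
    rw [biduality_naturality S.g j h₂.ext_lt h₃]
    exact hw

include hS in
theorem isGCDimZero_X₃ [IsNoetherianRing R] (hC : IsSemidualizing C) (h₁ : IsGCDimZero C j S.X₁)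
    (h₂ : IsGCDimZero C j S.X₂) [Nontrivial S.X₃]
    (hsurj : Function.Surjective (extMap S.f C j)) : IsGCDimZero C j S.X₃ := by
  have hlt := subsingleton_ext_X₃ hS C h₁.ext_lt h₂.ext_lt
  have hbij := biduality_X₃_bijective hS h₁ h₂ hsurj hlt
  have := h₂.finite
  have hfin : Module.Finite R S.X₃ :=
    Module.Finite.of_surjective S.g.hom ((ModuleCat.epi_iff_surjective S.g).1 hS.epi_g)
  have hnt : Nontrivial (Ext S.X₃ C j) := by
    have := hbij.1.nontrivial
    by_contra h
    rw [not_nontrivial_iff_subsingleton] at h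
    exact not_subsingleton _ (subsingleton_ext_of_subsingleton_left
      (X := ModuleCat.of R (Ext S.X₃ C j)) C j h)
  refine ⟨hfin, grade_eq_of_hasExtGrade (hC.hasExtGrade_self ⟨hlt, hnt⟩), hlt,
    subsingleton_ext_X₃_of_surjective hS h₁ h₂ hsurj, fun i hi => ?_, hbij⟩
  obtain ⟨_, hE⟩ := ext_shortExact hS h₁.ext_lt hsurj
  refine subsingleton_of_forall_eq 0 fun y => ?_
  have hs₁ := h₁.ext_ext_gt (i + 1) (by lia)
  have hs₂ := h₂.ext_ext_gt i hi
  obtain ⟨z, rfl⟩ := Ext.contravariant_sequence_exact₁ hE C y (n₁ := j + (i + 1)) (by lia)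
    (Subsingleton.elim (α := Ext (ModuleCat.of R (Ext S.X₁ C j)) C (j + (i + 1))) _ _)
  rw [Subsingleton.elim (α := Ext (ModuleCat.of R (Ext S.X₂ C j)) C (j + i)) z 0, Ext.comp_zero]

include hS in
/-- Given an exact sequence `0 ⟶ X₁ ⟶ X₂ ⟶ X₃ ⟶ 0` such that `Ext^i(T, X₁) = Ext^i(T, X₂) = 0` for
`i < e` and `Ext^e(T, X₁) ⟶ Ext^e(T, X₂)` is not injective, the smallest `i` with
`Ext^i(T, X₃) ≠ 0` is `e - 1`. -/
lemma hasExtGrade_X₃ {T : ModuleCat.{u} R} {e : ℕ} (h₁ : ∀ i < e, Subsingleton (Ext T S.X₁ i))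
    (h₂ : ∀ i < e, Subsingleton (Ext T S.X₂ i)) (β : Ext T S.X₁ e) (hβ : β ≠ 0)
    (hβ' : β.comp (Ext.mk₀ S.f) (add_zero e) = 0) :
    ∃ a, e = a + 1 ∧ HasExtGrade T S.X₃ a := by
  cases e with
  | zero =>
    have := hS.mono_f
    exact absurd (ext_comp_injective_of_mono S.f hβ') hβ
  | succ a =>
    refine ⟨a, rfl, fun i hi => subsingleton_of_forall_eq 0 fun x => ?_, ?_⟩
    · have := h₁ (i + 1) (by lia)
      have := h₂ i (by lia)
      obtain ⟨y, rfl⟩ := Ext.covariant_sequence_exact₃ _ hS x rfl (Subsingleton.elim _ _)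
      rw [Subsingleton.elim y 0, Ext.zero_comp]
    · obtain ⟨z, rfl⟩ := Ext.covariant_sequence_exact₁ _ hS β hβ' rfl
      refine nontrivial_of_ne z 0 ?_
      rintro rfl
      exact hβ (Ext.zero_comp ..)

section Local

variable [IsNoetherianRing R] [IsLocalRing R]

/-- Biduality and duality identify `Ext^e(k, X)` with `Hom(Ext^j(X, C), Ext^(e+j)(k, C))`, and `f`
acts there as precomposition with `extMap f C j`. A nonzero map vanishing on the image of `extMap f
C j` is thus a nonzero class killed by `f`. -/
lemma exists_comp_eq_zero_of_not_surjective [Module.Finite R C] {X Y : ModuleCat.{u} R}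
    (f : X ⟶ Y) (hX : IsGCDimZero C j X) (hY : IsGCDimZero C j Y) {e : ℕ}
    (hC : HasExtGrade (residueModule R) C (e + j))
    (hsurj : ¬ Function.Surjective (extMap f C j)) :
    ∃ β : Ext (residueModule R) X e, β ≠ 0 ∧ β.comp (Ext.mk₀ f) (add_zero e) = 0 := by
  have := hC.2
  have := hX.finite
  have : Nontrivial (Ext X C j ⧸ LinearMap.range (extMap f C j)) :=
    Submodule.Quotient.nontrivial_iff.2 fun h => hsurj (LinearMap.range_eq_top.1 h)
  obtain ⟨l₀, hl₀⟩ := exists_linearMap_ne_zero (annihilator_le_annihilator_ext_residueModule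
    (Ext X C j ⧸ LinearMap.range (extMap f C j)) C (e + j))
  let l := l₀ ∘ₗ (LinearMap.range (extMap f C j)).mkQ
  have hl : l ≠ 0 := fun h => hl₀ <| LinearMap.ext fun x => by
    obtain ⟨y, rfl⟩ := Submodule.mkQ_surjective _ x
    exact LinearMap.congr_fun h y
  have hl' (w : Ext Y C j) : l (extMap f C j w) = 0 := by
    have : (LinearMap.range (extMap f C j)).mkQ (extMap f C j w) = 0 :=
      (Submodule.Quotient.mk_eq_zero _).2 (LinearMap.mem_range_self _ w)
    exact (congrArg l₀ this).trans (map_zero l₀)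
  have hWX := subsingleton_ext_ext hX.ext_lt
  have := hY.finite
  have hWY := subsingleton_ext_ext hY.ext_lt
  obtain ⟨α, hα⟩ := exists_comp_biduality_eq (M := ModuleCat.of R (Ext X C j)) rfl hWX
    (.inr hX.subsingleton_ext_ext) hC.1 l
  set F := ModuleCat.ofHom (extMap f C j) with hF
  -- By naturality the class on the left corresponds to `l` composed with `extMap f C j`, which is
  -- zero.
  have hcomp : α.comp (Ext.mk₀ (ModuleCat.ofHom (extMap F C j))) (add_zero e) = 0 := by
    refine eq_zero_of_comp_biduality_eq_zero (M := ModuleCat.of R (Ext Y C j)) rfl hWY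
      (.inr hY.subsingleton_ext_ext) hC.1 _ fun w => ?_
    rw [Ext.comp_assoc_of_second_deg_zero, ← biduality_naturality F j hWY hWX w, hα]
    exact hl' w
  have hsq : f ≫ hY.iso.hom = hX.iso.hom ≫ ModuleCat.ofHom (extMap F C j) := by
    apply ModuleCat.hom_ext
    apply LinearMap.ext
    intro x
    exact biduality_naturality f j hX.ext_lt hY.ext_lt x
  refine ⟨α.comp (Ext.mk₀ hX.iso.inv) (add_zero e), fun h => hl ?_, ?_⟩
  · have : α = 0 := by
      rw [← Ext.comp_mk₀_id α, ← hX.iso.inv_hom_id, ← Ext.mk₀_comp_mk₀,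
        ← Ext.comp_assoc_of_third_deg_zero, h, Ext.zero_comp]
    ext w
    rw [← hα, this, Ext.zero_comp, LinearMap.zero_apply]
  · have hinv : hX.iso.inv ≫ f = ModuleCat.ofHom (extMap F C j) ≫ hY.iso.inv := by
      rw [Iso.inv_comp_eq, ← Category.assoc, ← hsq, Category.assoc, Iso.hom_inv_id,
        Category.comp_id]
    rw [Ext.comp_assoc_of_third_deg_zero, Ext.mk₀_comp_mk₀, hinv, ← Ext.mk₀_comp_mk₀,
      ← Ext.comp_assoc_of_third_deg_zero, hcomp, Ext.zero_comp]

end Local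

end ShortExact

/-! ### Resolutions and the depth count -/

section Resolution

variable {C M N : ModuleCat.{u} R} {j n : ℕ}

namespace GCResolution

/-- The resolution of length zero given by an isomorphism `N ≅ M`. -/
def ofEquiv (hN : IsGCDimZero C j N) (e : N ≃ₗ[R] M) : GCResolution C j M 0 where
  X
    | 0 => N
    | _ + 1 => ModuleCat.of R PUnit
  d _ := 0
  ε := e.toLinearMap
  isGCDimZero
    | 0, _ => hN
  subsingleton
    | _ + 1, _ => inferInstanceAs (Subsingleton PUnit)
  exact_d _ x := ⟨fun _ => ⟨0, rfl⟩, fun _ => rfl⟩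
  exact_ε x := ⟨fun h => ⟨0, ((map_eq_zero_iff e e.injective).1 h).symm⟩, by
    rintro ⟨y, rfl⟩
    exact map_zero e⟩
  surjective_ε := e.surjective

/-- The kernel of the augmentation `M_0 ⟶ M`. -/
abbrev syzygy (r : GCResolution C j M n) : ModuleCat.{u} R :=
  ModuleCat.of R (LinearMap.ker r.ε)

/-- The resolution of the first syzygy. -/
def tail (r : GCResolution C j M (n + 1)) : GCResolution C j r.syzygy n where
  X i := r.X (i + 1)
  d i := r.d (i + 1)
  ε := (r.d 0).codRestrict _ fun x => r.exact_ε.apply_apply_eq_zero x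
  isGCDimZero i hi := r.isGCDimZero (i + 1) (by lia)
  subsingleton i hi := r.subsingleton (i + 1) (by lia)
  exact_d i := r.exact_d (i + 1)
  exact_ε x := ⟨fun h => (r.exact_d 0 x).1 congr(($h).1),
    fun h => Subtype.ext ((r.exact_d 0 x).2 h)⟩
  surjective_ε := fun ⟨x, hx⟩ => by
    obtain ⟨y, rfl⟩ := (r.exact_ε x).1 hx
    exact ⟨y, rfl⟩

/-- A resolution of `M` from a resolution of the kernel of a surjection `N ⟶ M`. -/
def cons (hN : IsGCDimZero C j N) (ε : N →ₗ[R] M) (hε : Function.Surjective ε)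
    (r : GCResolution C j (ModuleCat.of R (LinearMap.ker ε)) n) : GCResolution C j M (n + 1) where
  X
    | 0 => N
    | i + 1 => r.X i
  d
    | 0 => (LinearMap.ker ε).subtype ∘ₗ r.ε
    | i + 1 => r.d i
  ε := ε
  isGCDimZero
    | 0, _ => hN
    | i + 1, hi => r.isGCDimZero i (by lia)
  subsingleton
    | i + 1, hi => r.subsingleton i (by lia)
  exact_d
    | 0 => fun x => by
      refine Iff.trans ?_ (r.exact_ε x)
      exact ⟨fun h => Subtype.ext h, fun h => congr(($h).1)⟩
    | i + 1 => r.exact_d i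
  exact_ε x := by
    constructor
    · intro hx
      obtain ⟨y, hy⟩ := r.surjective_ε ⟨x, hx⟩
      exact ⟨y, congr(($hy).1)⟩
    · rintro ⟨y, rfl⟩
      exact (r.ε y).2
  surjective_ε := hε

lemma ε_injective (r : GCResolution C j M 0) : Function.Injective r.ε := by
  rw [injective_iff_map_eq_zero]
  intro x hx
  obtain ⟨y, rfl⟩ := (r.exact_ε x).1 hx
  have := r.subsingleton 1 one_pos
  rw [Subsingleton.elim y 0, map_zero]

/-- A resolution `0 ⟶ M_0 ⟶ M ⟶ 0` is an isomorphism. -/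
def equiv (r : GCResolution C j M 0) : r.X 0 ≃ₗ[R] M :=
  LinearEquiv.ofBijective r.ε ⟨r.ε_injective, r.surjective_ε⟩

variable [IsNoetherianRing R] [IsLocalRing R]

/-- Stated as an alternative so that induction on the length applies to the syzygy without assuming
its resolution shortest. -/
theorem exists_lt_or_hasExtGrade (hC : IsSemidualizing C) {d : ℕ}
    (hd : HasExtGrade (residueModule R) C d) (n : ℕ) (M : ModuleCat.{u} R) [Nontrivial M]
    (r : GCResolution C j M n) :
    (∃ m < n, Nonempty (GCResolution C j M m)) ∨
      ∃ a, d = a + n + j ∧ HasExtGrade (residueModule R) M a := by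
  have := hC.finite
  have h₀ := r.isGCDimZero 0 n.zero_le
  obtain ⟨e, rfl, he⟩ := h₀.hasExtGrade hd
  induction n generalizing M with
  | zero => exact .inr ⟨e, rfl, he.of_iso r.equiv.toModuleIso⟩
  | succ n ih =>
    have hS := LinearMap.shortExact_shortComplexKer r.surjective_ε
    cases n with
    | zero =>
      let f : r.X 1 ⟶ r.X 0 := ModuleCat.ofHom (r.d 0)
      have h₁ := r.isGCDimZero 1 le_rfl
      have hinj : Function.Injective (r.d 0) := by
        rw [injective_iff_map_eq_zero]
        intro x hx
        obtain ⟨y, rfl⟩ := (r.exact_d 0 x).1 hx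
        have := r.subsingleton 2 one_lt_two
        rw [Subsingleton.elim y 0, map_zero]
      have hS : (ShortComplex.mk f (ModuleCat.ofHom r.ε)
          (ModuleCat.hom_ext r.exact_ε.linearMap_comp_eq_zero)).ShortExact :=
        { exact := ModuleCat.shortComplex_exact _ r.exact_ε
          mono_f := (ModuleCat.mono_iff_injective _).2 hinj
          epi_g := (ModuleCat.epi_iff_surjective _).2 r.surjective_ε }
      -- Both terms have depth `e`, so depth alone does not decide the depth of the cokernel;
      -- surjectivity on `Ext^j` does.
      by_cases hsurj : Function.Surjective (extMap f C j)
      · left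
        exact ⟨0, one_pos, ⟨ofEquiv (isGCDimZero_X₃ hS hC h₁ h₀ hsurj) (.refl R M)⟩⟩
      · right
        obtain ⟨β, hβ, hβ'⟩ := exists_comp_eq_zero_of_not_surjective f h₁ h₀ hd hsurj
        obtain ⟨e', hee, he'⟩ := h₁.hasExtGrade hd
        obtain rfl : e = e' := by lia
        obtain ⟨a, rfl, ha⟩ := hasExtGrade_X₃ hS he'.1 he.1 β hβ hβ'
        exact ⟨a, rfl, ha⟩
    | succ n =>
      cases subsingleton_or_nontrivial r.syzygy with
      | inl h =>
        have hinj : Function.Injective r.ε :=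
          LinearMap.ker_eq_bot.1 ((Submodule.subsingleton_iff_eq_bot).1 h)
        exact .inl ⟨0, by lia, ⟨ofEquiv h₀ (.ofBijective r.ε ⟨hinj, r.surjective_ε⟩)⟩⟩
      | inr h =>
        have h₁ := r.isGCDimZero 1 (by lia)
        obtain ⟨e', hee, he'⟩ := h₁.hasExtGrade hd
        obtain rfl : e = e' := by lia
        obtain ⟨m, hm, ⟨r'⟩⟩ | ⟨a, had, ha⟩ := ih r.syzygy r.tail h₁ he'
        · exact .inl ⟨m + 1, by lia, ⟨cons h₀ r.ε r.surjective_ε r'⟩⟩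
        -- The syzygy has depth `a = e - (n + 1) < e`, so any nonzero class in `Ext^a(k, syzygy)`
        -- dies in `Ext^a(k, M_0) = 0` and `M` has depth `a - 1`.
        · right
          have := ha.2
          obtain ⟨β, hβ⟩ := exists_ne (0 : Ext (residueModule R) r.syzygy a)
          have := he.1 a (by lia)
          obtain ⟨b, rfl, hb⟩ := hasExtGrade_X₃ hS ha.1 (fun i hi => he.1 i (by lia)) β hβ
            (Subsingleton.elim _ _)
          exact ⟨b, by lia, hb⟩

end GCResolution

lemma exists_gcDim_eq (h : gcDim C j M ≠ ⊤) :
    ∃ n : ℕ, gcDim C j M = n ∧ HasGCDimLE C j M n ∧ ∀ m < n, ¬ HasGCDimLE C j M m := by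
  classical
  have hex : ∃ n, HasGCDimLE C j M n := by
    by_contra! hn
    exact h (by simp [gcDim, hn])
  refine ⟨Nat.find hex, le_antisymm (iInf₂_le _ (Nat.find_spec hex)) ?_, Nat.find_spec hex,
    fun m hm => Nat.find_min hex hm⟩
  exact le_iInf₂ fun m hm => Nat.cast_le.2 (Nat.find_min' hex hm)

end Resolution

end IntermediateGorenstein

end

theorem corollary2 {R : Type u} [CommRing R] [IsNoetherianRing R] [IsLocalRing R]
    (C M : ModuleCat.{u} R) (hC : IntermediateGorenstein.IsSemidualizing C)
    [Module.Finite R M] [Nontrivial M] (j : ℕ)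
    (hM : IntermediateGorenstein.gcDim C j M ≠ ⊤) :
    ∃ n d e : ℕ,
      IntermediateGorenstein.gcDim C j M = n ∧
      IntermediateGorenstein.depth (ModuleCat.of R R) = d ∧
      IntermediateGorenstein.depth M = e ∧
      (n : ℤ) = d - e - j := by
  have := hC.finite
  have := hC.nontrivial
  obtain ⟨d, hd⟩ := IntermediateGorenstein.exists_hasExtGrade C
  obtain ⟨n, hn, ⟨hj, ⟨r⟩⟩, hmin⟩ := IntermediateGorenstein.exists_gcDim_eq hM
  obtain ⟨m, hm, hr⟩ | ⟨e, hde, he⟩ := r.exists_lt_or_hasExtGrade hC hd n M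
  -- A shorter resolution contradicts the choice of `n` as the dimension.
  · exact absurd ⟨hj, hr⟩ (hmin m hm)
  · exact ⟨n, d, e, hn, (hC.hasExtGrade_self hd).depth_eq, he.depth_eq, by lia⟩
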